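/- Let $k\ge 2$ be an integer, let $c,\alpha>0$, and let $M_n=\exp^{(k)}(c\,n^{\alpha})$ for $n\ge 0$, where $\exp^{(k)}$ and $\log^{(k)}$ denote the $k$-fold iterates of $\exp$ and $\log$. Let $\mathcal C_M([-1,1])$ be the class of real-valued $\psi\in C^\infty([-1,1])$ for which there is a constant $K>0$ with $\sup_{t\in[-1,1]}|\psi^{(n)}(t)|\le K^{n+1}M_n$ for all $n\ge 0$. For a phase $\psi$ put $$m(\lambda)=\mathrm{p.v.}\int_{-1}^{1}e^{i\lambda\psi(t)}\,\frac{dt}{t}=\lim_{\varepsilon\downarrow0}\int_{\varepsilon\le|t|\le1}e^{i\lambda\psi(t)}\,\frac{dt}{t}.$$ (i) If $\psi\in\mathcal C_M([-1,1])$, then the principal value $m(\lambda)$ exists for every real $\lambda$, and $$m(\lambda)=O\!\left(\frac{\log\lambda}{(\log^{(k)}\lambda)^{1/\alpha}}\right)\qquad(\lambda\to\infty),$$ where the implicit constant may depend on $\psi$ but not on $\lambda$. (ii) This bound is sharp: there are constants $B>0$ and $\delta>0$, with $\log^{(j)}(1/\delta)\ge2$ for $1\le j\le k$, such that the function $$\psi(t)=\begin{cases}0,&-1\le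 t\le0,\\ \exp\!\Bigl(-B\,\log\frac1{\delta t}\,\bigl(\log^{(k)}\frac1{\delta t}\bigr)^{1/\alpha}\Bigr),&0<t\le1,\end{cases}$$ belongs to $\mathcal C_M([-1,1])$, is flat at $0$ (that is, $\psi^{(n)}(0)=0$ for all $n\ge0$), and, for some sequence $\lambda_n\to\infty$, satisfies $$C^{-1}\,\frac{\log\lambda_n}{(\log^{(k)}\lambda_n)^{1/\alpha}}\le|m(\lambda_n)|\le C\,\frac{\log\lambda_n}{(\log^{(k)}\lambda_n)^{1/\alpha}}$$ for all sufficiently large $n$, with a constant $C>0$ independent of $n$. -/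

import Mathlib

open Filter Topology Asymptotics
open scoped ContDiff

noncomputable section

namespace SteinWainger

/-- The interval `[-1, 1]`. -/
def I : Set ℝ := Set.Icc (-1) 1

/-- The integral over `ε ≤ |t| ≤ 1` of `exp (i lam ψ(t)) / t`. -/
def truncated (ψ : ℝ → ℝ) (lam ε : ℝ) : ℂ :=
  (∫ t in (-1 : ℝ)..(-ε), Complex.exp (Complex.I * lam * ψ t) / t) +
    ∫ t in ε..(1 : ℝ), Complex.exp (Complex.I * lam * ψ t) / t

/-- The principal value `p.v. ∫_{[-1,1]} exp (i lam ψ(t)) dt / t` exists and equals `z`. -/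
def HasPrincipalValue (ψ : ℝ → ℝ) (lam : ℝ) (z : ℂ) : Prop :=
  Tendsto (truncated ψ lam) (𝓝[>] 0) (𝓝 z)

/-- The Stein–Wainger oscillatory integral `m(lam)` with phase `ψ`, as a principal value. -/
def m (ψ : ℝ → ℝ) (lam : ℝ) : ℂ :=
  limUnder (𝓝[>] (0 : ℝ)) (truncated ψ lam)

/-- The Denjoy–Carleman class of real-valued functions on `[-1,1]` with weight sequence `M`. -/
def DenjoyCarleman (M : ℕ → ℝ) (ψ : ℝ → ℝ) : Prop :=
  ContDiffOn ℝ ∞ ψ I ∧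
    ∃ K : ℝ, 0 < K ∧ ∀ n : ℕ, ∀ t ∈ I, |iteratedDerivWithin n ψ I t| ≤ K ^ (n + 1) * M n

/-- `M_n = exp^{(k)} (c n^α)`. -/
def weight (k : ℕ) (c α : ℝ) (n : ℕ) : ℝ :=
  Real.exp^[k] (c * (n : ℝ) ^ α)

/-- `log x / (log^{(k)} x)^{1/α}`. -/
def growth (k : ℕ) (α x : ℝ) : ℝ :=
  Real.log x / (Real.log^[k] x) ^ (1 / α)

/-- The phase that is `0` for `t ≤ 0` and
`exp (-B log(1/(δt)) (log^{(k)} (1/(δt)))^{1/α})` for `t > 0`. -/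
def flatPhase (k : ℕ) (α B δ t : ℝ) : ℝ :=
  if t ≤ 0 then 0
  else Real.exp (-(B * Real.log (1 / (δ * t)) * (Real.log^[k] (1 / (δ * t))) ^ (1 / α)))

/-- All derivatives of `ψ` (including the zeroth) vanish at `0`. -/
def FlatAtZero (ψ : ℝ → ℝ) : Prop :=
  ∀ n : ℕ, iteratedDerivWithin n ψ I 0 = 0

end SteinWainger

end

/-!
Upper bound. Pairing `t` with `-t` turns `m(lam)` into an absolutely convergent integral over
`(0, 1]`. For a real polynomial phase such integrals obey the Stein–Wainger bound, uniform in the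
coefficients and polynomial in the degree: split `(0, b]` according to which monomial dominates the
phase; where the `j`-th one dominates, compare with an absolutely convergent integral for
`|a_j| t^j ≤ 1` and use van der Corput for `|a_j| t^j ≥ 1`, and control the remaining set by its
logarithmic measure. Replace `ψ` on `|t| ≤ ε` by its Taylor polynomial of order `n` and estimate the
part `|t| ≥ ε` trivially by `2 log (1/ε)`. With `M_{n+1} ≤ lam` and `ε ≈ lam^{-2/(n+1)}` the Taylor
remainder is harmless, and the largest admissible `n` is about `(log^{(k)} lam / c)^{1/α}`.

Sharpness. On the discs `|z - t| ≤ η t` the flat phase extends holomorphically and still decays like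
the phase with `B` halved, so Cauchy's estimates bound its derivatives by the weights and show that
it glues smoothly to `0`. As `ψ = 0` on the negative axis, `|m(lam)|` dominates
`∫_t^1 (1 - cos (lam ψ(u))) du/u`, whose average over `lam ∈ [4/ψ(t), 8/ψ(t)]` is at least
`log (1/t) / 2`; for such `lam` the quantity `log lam / (log^{(k)} lam)^{1/α}` is `O(log (1/t))`.
-/

noncomputable section

namespace SteinWainger

open MeasureTheory Set
open scoped Polynomial

section IntegrationByParts

variable {p q q' r : ℝ → ℝ} {u v : ℝ}

theorem integral_exp_mul_eq (huv : u ≤ v)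
    (hp : ∀ t ∈ Icc u v, HasDerivAt p (q t * r t) t)
    (hq : ∀ t ∈ Icc u v, HasDerivAt q (q' t) t) (hq0 : ∀ t ∈ Icc u v, q t ≠ 0)
    (hq' : ContinuousOn q' (Icc u v)) (hr : ContinuousOn r (Icc u v)) :
    ∫ t in u..v, Complex.exp (Complex.I * p t) * r t =
      Complex.exp (Complex.I * p v) / (Complex.I * q v) -
        Complex.exp (Complex.I * p u) / (Complex.I * q u) +
        ∫ t in u..v, Complex.exp (Complex.I * p t) * q' t / (Complex.I * q t ^ 2) := by
  have hpc : ContinuousOn p (Icc u v) := fun t ht => (hp t ht).continuousAt.continuousWithinAt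
  have hqc : ContinuousOn q (Icc u v) := fun t ht => (hq t ht).continuousAt.continuousWithinAt
  have hqC : ∀ t ∈ Icc u v, (q t : ℂ) ≠ 0 := fun t ht => by exact_mod_cast hq0 t ht
  have hinv : ∀ t ∈ uIcc u v, HasDerivAt (fun t => (Complex.I * q t : ℂ)⁻¹)
      (-(q' t / (Complex.I * q t ^ 2))) t := fun t ht => by
    rw [uIcc_of_le huv] at ht
    refine (((hq t ht).ofReal_comp.const_mul Complex.I).inv
      (mul_ne_zero Complex.I_ne_zero (hqC t ht))).congr_deriv ?_
    have := hqC t ht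
    have := Complex.I_ne_zero
    field_simp
  have hexp : ∀ t ∈ uIcc u v, HasDerivAt (fun t => Complex.exp (Complex.I * p t))
      (Complex.exp (Complex.I * p t) * (Complex.I * (q t * r t))) t := fun t ht => by
    rw [uIcc_of_le huv] at ht
    exact_mod_cast ((hp t ht).ofReal_comp.const_mul Complex.I).cexp
  rw [← uIcc_of_le huv] at *
  have hinv_int : IntervalIntegrable (fun t => -(q' t / (Complex.I * q t ^ 2) : ℂ)) volume u v :=
    ContinuousOn.intervalIntegrable <| (ContinuousOn.div (by fun_prop) (by fun_prop) fun t ht =>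
      mul_ne_zero Complex.I_ne_zero (pow_ne_zero 2 (hqC t ht))).neg
  have hexp_int : IntervalIntegrable
      (fun t => Complex.exp (Complex.I * p t) * (Complex.I * (q t * r t))) volume u v :=
    ContinuousOn.intervalIntegrable (by fun_prop)
  have hparts := intervalIntegral.integral_mul_deriv_eq_deriv_mul hinv hexp hinv_int hexp_int
  have hlhs : ∫ t in u..v, Complex.exp (Complex.I * p t) * r t = ∫ t in u..v,
      (Complex.I * q t : ℂ)⁻¹ * (Complex.exp (Complex.I * p t) * (Complex.I * (q t * r t))) :=
    intervalIntegral.integral_congr fun t ht => by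
      have := hqC t ht
      have := Complex.I_ne_zero
      field_simp
  rw [hlhs, hparts]
  simp_rw [neg_mul, intervalIntegral.integral_neg, sub_neg_eq_add, inv_mul_eq_div,
    div_mul_eq_mul_div, mul_comm (q' _ : ℂ)]

theorem norm_integral_exp_mul_le (huv : u ≤ v)
    (hp : ∀ t ∈ Icc u v, HasDerivAt p (q t * r t) t)
    (hq : ∀ t ∈ Icc u v, HasDerivAt q (q' t) t) (hq0 : ∀ t ∈ Icc u v, q t ≠ 0)
    (hq' : ContinuousOn q' (Icc u v)) (hr : ContinuousOn r (Icc u v)) :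
    ‖∫ t in u..v, Complex.exp (Complex.I * p t) * r t‖ ≤
      1 / |q v| + 1 / |q u| + ∫ t in u..v, |q' t| / q t ^ 2 := by
  rw [integral_exp_mul_eq huv hp hq hq0 hq' hr]
  refine (norm_add_le _ _).trans (add_le_add ((norm_sub_le _ _).trans_eq ?_)
    ((intervalIntegral.norm_integral_le_integral_norm huv).trans_eq ?_))
  all_goals simp

theorem integral_inv_mul_pow_succ_le {j : ℕ} {A : ℝ} (hj : j ≠ 0) (hu : 0 < u) (huv : u ≤ v)
    (hA : 0 < A) (hAu : 1 ≤ A * u ^ j) : ∫ t in u..v, (A * t ^ (j + 1))⁻¹ ≤ 1 := by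
  have hj1 : (1 : ℝ) ≤ j := by exact_mod_cast Nat.one_le_iff_ne_zero.2 hj
  have hpos : ∀ t ∈ uIcc u v, 0 < t := fun t ht => hu.trans_le (uIcc_of_le huv ▸ ht).1
  have hderiv : ∀ t ∈ uIcc u v,
      HasDerivAt (fun t : ℝ => -(j * A)⁻¹ * (t ^ j)⁻¹) (A * t ^ (j + 1))⁻¹ t := fun t ht => by
    have := hpos t ht
    refine (((hasDerivAt_pow j t).inv (by positivity)).const_mul _).congr_deriv ?_
    obtain ⟨i, rfl⟩ := Nat.exists_eq_succ_of_ne_zero hj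
    simp only [Nat.succ_eq_add_one, Nat.add_sub_cancel]
    field_simp
    ring
  have hcont : ContinuousOn (fun t : ℝ => (A * t ^ (j + 1))⁻¹) (uIcc u v) :=
    ContinuousOn.inv₀ (by fun_prop) fun t ht => by have := hpos t ht; positivity
  rw [intervalIntegral.integral_eq_sub_of_hasDerivAt hderiv hcont.intervalIntegrable]
  have hv : 0 < v := hu.trans_le huv
  have hlast : 0 ≤ (j * A)⁻¹ * (v ^ j)⁻¹ := by positivity
  have hfirst : (j * A)⁻¹ * (u ^ j)⁻¹ ≤ 1 := by
    rw [← mul_inv]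
    exact inv_le_one_of_one_le₀ (by nlinarith)
  linarith

theorem abs_div_sq_le_of_monomial_bounds {A t x y : ℝ} {j : ℕ} (hA : 0 < A) (ht : 0 < t)
    (hx : x ≠ 0) (hlow : j * (A * t ^ j) ≤ 2 * |x|) (hup : |t * y| ≤ 2 * j ^ 2 * (A * t ^ j)) :
    |y| / x ^ 2 ≤ 8 * (A * t ^ (j + 1))⁻¹ := by
  rw [abs_mul, abs_of_pos ht] at hup
  rw [← div_eq_mul_inv, div_le_div_iff₀ (pow_two_pos_of_ne_zero hx) (by positivity)]
  calc |y| * (A * t ^ (j + 1)) = t * |y| * (A * t ^ j) := by ring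
    _ ≤ 2 * j ^ 2 * (A * t ^ j) * (A * t ^ j) := by gcongr
    _ = 2 * (j * (A * t ^ j)) ^ 2 := by ring
    _ ≤ 2 * (2 * |x|) ^ 2 :=
        mul_le_mul_of_nonneg_left (pow_le_pow_left₀ (by positivity) hlow 2) two_pos.le
    _ = 8 * x ^ 2 := by rw [mul_pow, sq_abs]; ring

theorem norm_integral_exp_mul_inv_le_of_monomial_bounds {A : ℝ} {j : ℕ} (hj : j ≠ 0) (hu : 0 < u)
    (huv : u ≤ v) (hA : 0 < A) (hAu : 1 ≤ A * u ^ j)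
    (hp : ∀ t ∈ Icc u v, HasDerivAt p (q t * t⁻¹) t)
    (hq : ∀ t ∈ Icc u v, HasDerivAt q (q' t) t) (hq' : ContinuousOn q' (Icc u v))
    (hlow : ∀ t ∈ Icc u v, j * (A * t ^ j) ≤ 2 * |q t|)
    (hup : ∀ t ∈ Icc u v, |t * q' t| ≤ 2 * j ^ 2 * (A * t ^ j)) :
    ‖∫ t in u..v, Complex.exp (Complex.I * p t) * (t⁻¹ : ℝ)‖ ≤ 12 := by
  have hj1 : (1 : ℝ) ≤ j := by exact_mod_cast Nat.one_le_iff_ne_zero.2 hj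
  have hpos : ∀ t ∈ Icc u v, 0 < t := fun t ht => hu.trans_le ht.1
  have hq1 : ∀ t ∈ Icc u v, 1 / 2 ≤ |q t| := fun t ht => by
    have : 1 ≤ A * t ^ j := hAu.trans (by gcongr; exact ht.1)
    nlinarith [hlow t ht]
  have hq0 : ∀ t ∈ Icc u v, q t ≠ 0 := fun t ht h0 => by
    have := hq1 t ht
    norm_num [h0] at this
  have hend : ∀ t ∈ Icc u v, 1 / |q t| ≤ 2 := fun t ht => by
    rw [one_div]
    exact inv_le_of_inv_le₀ two_pos (by simpa using hq1 t ht)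
  have hratio : ∀ t ∈ Icc u v, |q' t| / q t ^ 2 ≤ 8 * (A * t ^ (j + 1))⁻¹ := fun t ht =>
    abs_div_sq_le_of_monomial_bounds hA (hpos t ht) (hq0 t ht) (hlow t ht) (hup t ht)
  have hqc : ContinuousOn q (Icc u v) := fun t ht => (hq t ht).continuousAt.continuousWithinAt
  have hintegral : ∫ t in u..v, |q' t| / q t ^ 2 ≤ 8 := by
    refine (intervalIntegral.integral_mono_on huv ?_ ?_ hratio).trans ?_
    · exact ContinuousOn.intervalIntegrable_of_Icc huv
        (hq'.abs.div (hqc.pow 2) fun t ht => pow_ne_zero 2 (hq0 t ht))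
    · exact ContinuousOn.intervalIntegrable_of_Icc huv <| continuousOn_const.mul <|
        ContinuousOn.inv₀ (by fun_prop) fun t ht => by have := hpos t ht; positivity
    · rw [intervalIntegral.integral_const_mul]
      linarith [integral_inv_mul_pow_succ_le hj hu huv hA hAu]
  have hparts := norm_integral_exp_mul_le huv hp hq hq0 hq'
    (continuousOn_id.inv₀ fun t ht => (hpos t ht).ne')
  linarith [hend u ⟨le_rfl, huv⟩, hend v ⟨huv, le_rfl⟩]

end IntegrationByParts

section DominantMonomial

/-- The Euler operator `p ↦ t p'(t)`, which multiplies the coefficient of `t ^ i` by `i`. -/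
def euler (p : ℝ[X]) : ℝ[X] := Polynomial.X * p.derivative

/-- The set of `t > 0` at which the monomial of degree `j` of `p` exceeds every other nonconstant
monomial by the factor `N`. The constant term is ignored, since it only rotates `e ^ (i p)`. -/
def dominantSet (p : ℝ[X]) (N : ℝ) (j : ℕ) : Set ℝ :=
  {t | 0 < t ∧ ∀ i, i ≠ 0 → i ≠ j → N * (|p.coeff i| * t ^ i) ≤ |p.coeff j| * t ^ j}

variable {p q : ℝ[X]} {N t : ℝ} {j : ℕ}

theorem coeff_euler (p : ℝ[X]) (i : ℕ) : (euler p).coeff i = i * p.coeff i := by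
  cases i with
  | zero => simp [euler]
  | succ i => simp [euler, Polynomial.coeff_X_mul, Polynomial.coeff_derivative, mul_comm]

theorem natDegree_euler_le (p : ℝ[X]) : (euler p).natDegree ≤ p.natDegree :=
  Polynomial.natDegree_le_iff_coeff_eq_zero.2 fun i hi => by
    rw [coeff_euler, Polynomial.coeff_eq_zero_of_natDegree_lt hi, mul_zero]

theorem hasDerivAt_eval_euler (p : ℝ[X]) (ht : t ≠ 0) :
    HasDerivAt (fun t => p.eval t) ((euler p).eval t * t⁻¹) t := by
  refine (p.hasDerivAt t).congr_deriv ?_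
  rw [euler, Polynomial.eval_mul, Polynomial.eval_X, mul_comm t, mul_inv_cancel_right₀ ht]

theorem coeff_comp_neg_X (p : ℝ[X]) (i : ℕ) :
    (p.comp (-Polynomial.X)).coeff i = (-1) ^ i * p.coeff i := by
  have h := Polynomial.comp_C_mul_X_coeff (p := p) (r := (-1 : ℝ)) (n := i)
  rwa [map_neg, map_one, neg_one_mul, mul_comm] at h

theorem natDegree_comp_neg_X (p : ℝ[X]) :
    (p.comp (-Polynomial.X)).natDegree = p.natDegree := by
  simp [Polynomial.natDegree_comp]

theorem dominantSet_comp_neg_X (p : ℝ[X]) (N : ℝ) (j : ℕ) :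
    dominantSet (p.comp (-Polynomial.X)) N j = dominantSet p N j := by
  simp [dominantSet, coeff_comp_neg_X, abs_mul, abs_pow]

theorem ordConnected_dominantSet (hN : 0 ≤ N) : (dominantSet p N j).OrdConnected := by
  refine ⟨fun u hu v hv t ht => ?_⟩
  have hu0 : 0 < u := hu.1
  have hv0 : 0 < v := hv.1
  have ht0 : 0 < t := hu0.trans_le ht.1
  refine ⟨ht0, fun i hi hij => ?_⟩
  rcases lt_or_gt_of_ne hij with h | h
  · obtain ⟨e, rfl⟩ := Nat.exists_eq_add_of_lt h
    have hu_low : N * |p.coeff i| ≤ |p.coeff (i + e + 1)| * u ^ (e + 1) :=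
      le_of_mul_le_mul_right (by linear_combination hu.2 i hi hij) (pow_pos hu0 i)
    calc N * (|p.coeff i| * t ^ i) = N * |p.coeff i| * t ^ i := by ring
      _ ≤ |p.coeff (i + e + 1)| * u ^ (e + 1) * t ^ i := by gcongr
      _ ≤ |p.coeff (i + e + 1)| * t ^ (e + 1) * t ^ i := by gcongr; exact ht.1
      _ = _ := by ring
  · obtain ⟨e, rfl⟩ := Nat.exists_eq_add_of_lt h
    have hv_high : N * |p.coeff (j + e + 1)| * v ^ (e + 1) ≤ |p.coeff j| :=
      le_of_mul_le_mul_right (by linear_combination hv.2 _ hi hij) (pow_pos hv0 j)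
    calc N * (|p.coeff (j + e + 1)| * t ^ (j + e + 1))
        = N * |p.coeff (j + e + 1)| * t ^ (e + 1) * t ^ j := by ring
      _ ≤ N * |p.coeff (j + e + 1)| * v ^ (e + 1) * t ^ j := by gcongr; exact ht.2
      _ ≤ |p.coeff j| * t ^ j := by gcongr

theorem measurableSet_dominantSet (hN : 0 ≤ N) : MeasurableSet (dominantSet p N j) :=
  (ordConnected_dominantSet hN).measurableSet

theorem isCompact_dominantSet_inter_Icc {w : ℝ} (hw : 0 < w) (b : ℝ) :
    IsCompact (dominantSet p N j ∩ Icc w b) := by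
  have h : dominantSet p N j ∩ Icc w b = Icc w b ∩ ⋂ i, ⋂ (_ : i ≠ 0), ⋂ (_ : i ≠ j),
      {t : ℝ | N * (|p.coeff i| * t ^ i) ≤ |p.coeff j| * t ^ j} := by
    ext t
    simp only [dominantSet, mem_inter_iff, mem_iInter, mem_ofPred_eq, mem_Icc]
    exact ⟨fun h => ⟨h.2, h.1.2⟩, fun h => ⟨⟨hw.trans_le h.1.1, h.2⟩, h.1⟩⟩
  rw [h]
  exact isCompact_Icc.inter_right <| isClosed_iInter fun i => isClosed_iInter fun _ =>
    isClosed_iInter fun _ => isClosed_le (by fun_prop) (by fun_prop)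

theorem abs_eval_sub_le_of_mem_dominantSet {d : ℕ} {W : ℝ} (hq0 : q.coeff 0 = 0)
    (hqd : q.natDegree ≤ d) (hqp : ∀ i ≤ d, |q.coeff i| ≤ W * |p.coeff i|) (hN : 2 * d * W ≤ N)
    (ht : t ∈ dominantSet p N j) :
    |q.eval t - q.coeff j * t ^ j| ≤ |p.coeff j| * t ^ j / 2 := by
  have ht0 : 0 < t := ht.1
  have hmem : ∀ i ∈ (q.erase j).support, i ≠ j ∧ i ∈ Finset.Icc 1 d := fun i hi => by
    rw [Polynomial.support_erase, Finset.mem_erase, Polynomial.mem_support_iff] at hi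
    refine ⟨hi.1, Finset.mem_Icc.2 ⟨Nat.one_le_iff_ne_zero.2 ?_, ?_⟩⟩
    · rintro rfl; exact hi.2 hq0
    · exact (Polynomial.le_natDegree_of_ne_zero hi.2).trans hqd
  have hterm : ∀ i ∈ (q.erase j).support,
      |(q.erase j).coeff i * t ^ i| ≤ |p.coeff j| * t ^ j / (2 * d) := fun i hi => by
    obtain ⟨hij, hid⟩ := hmem i hi
    rw [Finset.mem_Icc] at hid
    have hd : (0 : ℝ) < d := by exact_mod_cast hid.1.trans hid.2
    rw [Polynomial.erase_ne _ hij, abs_mul, abs_of_pos (pow_pos ht0 i),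
      le_div_iff₀ (by positivity)]
    calc |q.coeff i| * t ^ i * (2 * d) ≤ W * |p.coeff i| * t ^ i * (2 * d) := by
          gcongr; exact hqp i hid.2
      _ = 2 * d * W * (|p.coeff i| * t ^ i) := by ring
      _ ≤ N * (|p.coeff i| * t ^ i) := by gcongr
      _ ≤ |p.coeff j| * t ^ j := ht.2 i (Nat.one_le_iff_ne_zero.1 hid.1) hij
  have heval : q.eval t - q.coeff j * t ^ j = (q.erase j).eval t := by
    conv_lhs => rw [← q.monomial_add_erase j]
    simp
  rw [heval, Polynomial.eval_eq_sum, Polynomial.sum]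
  calc _ ≤ ∑ i ∈ (q.erase j).support, |(q.erase j).coeff i * t ^ i| :=
        Finset.abs_sum_le_sum_abs _ _
    _ ≤ (q.erase j).support.card • (|p.coeff j| * t ^ j / (2 * d)) :=
        Finset.sum_le_card_nsmul _ _ _ hterm
    _ ≤ d * (|p.coeff j| * t ^ j / (2 * d)) := by
        rw [nsmul_eq_mul]
        gcongr
        simpa using Finset.card_le_card fun i hi => (hmem i hi).2
    _ ≤ |p.coeff j| * t ^ j / 2 := by
        rcases d.eq_zero_or_pos with rfl | hd
        · simp only [CharP.cast_eq_zero, mul_zero, div_zero]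
          positivity
        · refine le_of_eq ?_
          field_simp

theorem abs_eval_euler_sub_le (hN : 4 * (p.natDegree : ℝ) ^ 3 ≤ N) (ht : t ∈ dominantSet p N j) :
    |(euler p).eval t - j * p.coeff j * t ^ j| ≤ |p.coeff j| * t ^ j / 2 := by
  rw [← coeff_euler]
  refine abs_eval_sub_le_of_mem_dominantSet (by simp [euler]) (natDegree_euler_le p)
    (fun i hi => ?_) ?_ ht (W := p.natDegree)
  · rw [coeff_euler, abs_mul, Nat.abs_cast]
    gcongr
  · have : (p.natDegree : ℝ) ^ 2 ≤ (p.natDegree : ℝ) ^ 3 := by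
      rcases p.natDegree.eq_zero_or_pos with h | h
      · simp [h]
      · exact_mod_cast Nat.pow_le_pow_right h (by norm_num)
    nlinarith

theorem abs_eval_euler_euler_sub_le (hN : 4 * (p.natDegree : ℝ) ^ 3 ≤ N)
    (ht : t ∈ dominantSet p N j) :
    |(euler (euler p)).eval t - j ^ 2 * p.coeff j * t ^ j| ≤ |p.coeff j| * t ^ j / 2 := by
  have hcoeff : ∀ i, (euler (euler p)).coeff i = i ^ 2 * p.coeff i := fun i => by
    rw [coeff_euler, coeff_euler, ← mul_assoc, sq]
  rw [← hcoeff]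
  refine abs_eval_sub_le_of_mem_dominantSet (by simp [euler])
    ((natDegree_euler_le _).trans (natDegree_euler_le p)) (fun i hi => ?_) ?_ ht
    (W := p.natDegree ^ 2)
  · rw [hcoeff, abs_mul, abs_pow, Nat.abs_cast]
    gcongr
  · have : 0 ≤ (p.natDegree : ℝ) ^ 3 := by positivity
    linarith

theorem abs_eval_sub_eval_neg_le (hN : 4 * (p.natDegree : ℝ) ^ 3 ≤ N)
    (ht : t ∈ dominantSet p N j) :
    |p.eval t - p.eval (-t)| ≤ 3 * (|p.coeff j| * t ^ j) := by
  have hsign : ∀ i : ℕ, |1 - (-1 : ℝ) ^ i| ≤ 2 := fun i => by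
    rcases neg_one_pow_eq_or ℝ i with h | h <;> norm_num [h]
  have hcoeff : ∀ i, (p - p.comp (-Polynomial.X)).coeff i = (1 - (-1) ^ i) * p.coeff i :=
    fun i => by rw [Polynomial.coeff_sub, coeff_comp_neg_X]; ring
  have hbound : ∀ i, |(p - p.comp (-Polynomial.X)).coeff i| ≤ 2 * |p.coeff i| := fun i => by
    rw [hcoeff, abs_mul]
    gcongr
    exact hsign i
  have hclose := abs_eval_sub_le_of_mem_dominantSet (by rw [hcoeff]; simp)
    ((Polynomial.natDegree_sub_le _ _).trans_eq
      (by rw [natDegree_comp_neg_X, max_self])) (fun i _ => hbound i) (N := N) (j := j) (t := t)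
    (by
      have : (p.natDegree : ℝ) ≤ (p.natDegree : ℝ) ^ 3 := by
        exact_mod_cast Nat.le_self_pow three_ne_zero _
      linarith) ht
  have htj : 0 < t ^ j := pow_pos ht.1 j
  have hmain : |(p - p.comp (-Polynomial.X)).coeff j * t ^ j| ≤ 2 * (|p.coeff j| * t ^ j) := by
    rw [abs_mul, abs_of_pos htj, ← mul_assoc]
    exact mul_le_mul_of_nonneg_right (hbound j) htj.le
  have heval : p.eval t - p.eval (-t) = (p - p.comp (-Polynomial.X)).eval t := by simp
  rw [heval]
  have := abs_sub_abs_le_abs_sub ((p - p.comp (-Polynomial.X)).eval t)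
    ((p - p.comp (-Polynomial.X)).coeff j * t ^ j)
  have : 0 ≤ |p.coeff j| * t ^ j := by positivity
  linarith

theorem norm_integral_exp_eval_mul_inv_le (hj : j ≠ 0) (hN : 4 * (p.natDegree : ℝ) ^ 3 ≤ N)
    (hpj : p.coeff j ≠ 0) {u v : ℝ} (huv : u ≤ v) (hsub : Icc u v ⊆ dominantSet p N j)
    (hu : 1 ≤ |p.coeff j| * u ^ j) :
    ‖∫ t in u..v, Complex.exp (Complex.I * p.eval t) * (t⁻¹ : ℝ)‖ ≤ 12 := by
  have hpos : ∀ t ∈ Icc u v, 0 < t := fun t ht => (hsub ht).1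
  have hj1 : (1 : ℝ) ≤ j := by exact_mod_cast Nat.one_le_iff_ne_zero.2 hj
  have habs : ∀ t > 0, ∀ l : ℕ, |(j : ℝ) ^ l * p.coeff j * t ^ j| = j ^ l * (|p.coeff j| * t ^ j) :=
    fun t ht l => by
      rw [abs_mul, abs_mul, abs_of_pos (pow_pos ht j), abs_pow, Nat.abs_cast, mul_assoc]
  refine norm_integral_exp_mul_inv_le_of_monomial_bounds (q := fun t => (euler p).eval t)
    (q' := fun t => (euler (euler p)).eval t * t⁻¹) hj (hsub ⟨le_rfl, huv⟩).1 huv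
    (abs_pos.2 hpj) hu (fun t ht => hasDerivAt_eval_euler p (hpos t ht).ne')
    (fun t ht => hasDerivAt_eval_euler _ (hpos t ht).ne')
    ((Polynomial.continuousOn _).mul (continuousOn_id.inv₀ fun t ht => (hpos t ht).ne'))
    (fun t ht => ?_) (fun t ht => ?_)
  · have hclose := abs_eval_euler_sub_le hN (hsub ht)
    rw [abs_sub_comm] at hclose
    have := abs_sub_abs_le_abs_sub (j * p.coeff j * t ^ j) ((euler p).eval t)
    have hmain := habs t (hpos t ht) 1
    rw [pow_one] at hmain
    have : 0 ≤ |p.coeff j| * t ^ j := by have := hpos t ht; positivity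
    nlinarith
  · have hclose := abs_eval_euler_euler_sub_le hN (hsub ht)
    have := abs_sub_abs_le_abs_sub ((euler (euler p)).eval t) (j ^ 2 * p.coeff j * t ^ j)
    have hmain := habs t (hpos t ht) 2
    have hX : 0 ≤ |p.coeff j| * t ^ j := by have := hpos t ht; positivity
    have : |p.coeff j| * t ^ j ≤ j ^ 2 * (|p.coeff j| * t ^ j) :=
      le_mul_of_one_le_left hX (one_le_pow₀ hj1)
    rw [mul_comm t, inv_mul_cancel_right₀ (hpos t ht).ne']
    linarith

end DominantMonomial

section OddKernel

/-- The kernel `(e ^ (i φ(t)) - e ^ (i φ(-t))) / t`, whose integral over `(0, 1]` is the principal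
value of `e ^ (i φ(t)) / t` over `[-1, 1]`. -/
def oddKernel (φ : ℝ → ℝ) (t : ℝ) : ℂ :=
  (Complex.exp (Complex.I * φ t) - Complex.exp (Complex.I * φ (-t))) / t

theorem norm_exp_I_mul_sub_le (x y : ℝ) :
    ‖Complex.exp (Complex.I * x) - Complex.exp (Complex.I * y)‖ ≤ |x - y| := by
  have h : Complex.exp (Complex.I * x) - Complex.exp (Complex.I * y)
      = Complex.exp (Complex.I * y) * (Complex.exp (Complex.I * (x - y : ℝ)) - 1) := by
    rw [mul_sub, ← Complex.exp_add, mul_one, ← mul_add, Complex.ofReal_sub, add_sub_cancel]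
  rw [h, norm_mul, mul_comm Complex.I (y : ℂ), Complex.norm_exp_ofReal_mul_I, one_mul]
  exact Real.norm_exp_I_mul_ofReal_sub_one_le

theorem norm_oddKernel_le (φ : ℝ → ℝ) {t : ℝ} (ht : 0 < t) : ‖oddKernel φ t‖ ≤ 2 / t := by
  rw [oddKernel, norm_div, Complex.norm_real, Real.norm_of_nonneg ht.le]
  gcongr
  refine (norm_sub_le _ _).trans ?_
  rw [mul_comm, Complex.norm_exp_ofReal_mul_I, mul_comm, Complex.norm_exp_ofReal_mul_I]
  norm_num

theorem norm_oddKernel_le_abs_sub (φ : ℝ → ℝ) {t : ℝ} (ht : 0 < t) :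
    ‖oddKernel φ t‖ ≤ |φ t - φ (-t)| / t := by
  rw [oddKernel, norm_div, Complex.norm_real, Real.norm_of_nonneg ht.le]
  gcongr
  exact norm_exp_I_mul_sub_le _ _

theorem norm_oddKernel_sub_le (φ χ : ℝ → ℝ) {t : ℝ} (ht : 0 < t) :
    ‖oddKernel φ t - oddKernel χ t‖ ≤ (|φ t - χ t| + |φ (-t) - χ (-t)|) / t := by
  rw [oddKernel, oddKernel, ← sub_div, norm_div, Complex.norm_real, Real.norm_of_nonneg ht.le]
  gcongr
  rw [sub_sub_sub_comm]
  exact (norm_sub_le _ _).trans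
    (add_le_add (norm_exp_I_mul_sub_le _ _) (norm_exp_I_mul_sub_le _ _))

theorem integrableOn_oddKernel {φ : ℝ → ℝ} {C b : ℝ} (hφ : ContinuousOn φ (Icc (-b) b))
    (hC : ∀ t ∈ Ioc 0 b, |φ t - φ (-t)| ≤ C * t) : IntegrableOn (oddKernel φ) (Ioc 0 b) := by
  have hpos : ContinuousOn φ (Ioc 0 b) := hφ.mono fun t ht => ⟨by linarith [ht.1, ht.2], ht.2⟩
  have hneg : ContinuousOn (fun t => φ (-t)) (Ioc 0 b) :=
    hφ.comp continuousOn_neg fun t ht => ⟨neg_le_neg ht.2, by linarith [ht.1, ht.2]⟩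
  have hcont : ContinuousOn (oddKernel φ) (Ioc 0 b) :=
    ((continuousOn_const.mul (Complex.continuous_ofReal.comp_continuousOn hpos)).cexp.sub
      (continuousOn_const.mul (Complex.continuous_ofReal.comp_continuousOn hneg)).cexp).div
      Complex.continuous_ofReal.continuousOn fun t ht => by exact_mod_cast ht.1.ne'
  refine IntegrableOn.of_bound (C := C) (by simp) (hcont.aestronglyMeasurable measurableSet_Ioc) ?_
  refine (ae_restrict_mem measurableSet_Ioc).mono fun t ht => ?_
  refine (norm_oddKernel_le_abs_sub φ ht.1).trans ?_
  rw [div_le_iff₀ ht.1]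
  exact hC t ht

theorem integrableOn_oddKernel_eval (p : ℝ[X]) (b : ℝ) :
    IntegrableOn (oddKernel fun t => p.eval t) (Ioc 0 b) := by
  have hp : ContDiff ℝ 1 fun t => p.eval t := p.contDiff_aeval 1
  obtain ⟨K, hK⟩ :=
    hp.contDiffOn.exists_lipschitzOnWith one_ne_zero (convex_Icc (-b) b) isCompact_Icc
  refine integrableOn_oddKernel (C := 2 * K) p.continuousOn fun t ht => ?_
  have h := hK.dist_le_mul t ⟨by linarith [ht.1, ht.2], ht.2⟩ (-t)
    ⟨neg_le_neg ht.2, by linarith [ht.1, ht.2]⟩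
  rw [Real.dist_eq, Real.dist_eq, sub_neg_eq_add, abs_of_pos (add_pos ht.1 ht.1)] at h
  linarith

end OddKernel

section PolynomialPhase

variable {p : ℝ[X]} {N : ℝ} {j : ℕ}

theorem norm_setIntegral_oddKernel_eval_le_of_le_one (hj : j ≠ 0)
    (hN : 4 * (p.natDegree : ℝ) ^ 3 ≤ N) {w : ℝ} (hw : 0 ≤ w) (hwj : |p.coeff j| * w ^ j ≤ 1)
    {s : Set ℝ} (hs : MeasurableSet s) (hsub : s ⊆ dominantSet p N j ∩ Ioc 0 w) :
    ‖∫ t in s, oddKernel (fun t => p.eval t) t‖ ≤ 3 := by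
  obtain ⟨i, rfl⟩ := Nat.exists_eq_succ_of_ne_zero hj
  have hsw : s ⊆ Ioc 0 w := hsub.trans inter_subset_right
  have hint : IntegrableOn (fun t : ℝ => 3 * |p.coeff (i + 1)| * t ^ i) (Ioc 0 w) :=
    (Continuous.continuousOn (by fun_prop)).integrableOn_Icc.mono_set Ioc_subset_Icc_self
  calc _ ≤ ∫ t in s, 3 * |p.coeff (i + 1)| * t ^ i := by
        refine norm_integral_le_of_norm_le (hint.mono_set hsw)
          ((ae_restrict_mem hs).mono fun t ht => ?_)
        have ht0 : 0 < t := (hsw ht).1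
        refine (norm_oddKernel_le_abs_sub _ ht0).trans ?_
        rw [div_le_iff₀ ht0]
        refine (abs_eval_sub_eval_neg_le hN (hsub ht).1).trans_eq ?_
        rw [Nat.succ_eq_add_one]
        ring
    _ ≤ ∫ t in Ioc 0 w, 3 * |p.coeff (i + 1)| * t ^ i := by
        refine setIntegral_mono_set hint ?_ hsw.eventuallyLE
        refine (ae_restrict_mem measurableSet_Ioc).mono fun t ht => ?_
        have ht0 : 0 < t := ht.1
        simp only [Pi.zero_apply]
        positivity
    _ = 3 * (|p.coeff (i + 1)| * w ^ (i + 1) / (i + 1)) := by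
        rw [← intervalIntegral.integral_of_le hw, intervalIntegral.integral_const_mul,
          integral_pow]
        simp
        ring
    _ ≤ 3 * 1 := by
        gcongr
        exact (div_le_self (by positivity) (by linarith [i.cast_nonneg (α := ℝ)])).trans hwj
    _ = 3 := mul_one 3

theorem norm_intervalIntegral_oddKernel_eval_le (hj : j ≠ 0)
    (hN : 4 * (p.natDegree : ℝ) ^ 3 ≤ N) (hpj : p.coeff j ≠ 0) {u v : ℝ} (huv : u ≤ v)
    (hsub : Icc u v ⊆ dominantSet p N j) (hu : 1 ≤ |p.coeff j| * u ^ j) :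
    ‖∫ t in u..v, oddKernel (fun t => p.eval t) t‖ ≤ 24 := by
  have hint : ∀ q : ℝ[X], IntervalIntegrable
      (fun t : ℝ => Complex.exp (Complex.I * q.eval t) * (t⁻¹ : ℝ)) volume u v := fun q => by
    have hinv : ContinuousOn (fun t : ℝ => t⁻¹) (Icc u v) :=
      continuousOn_id.inv₀ fun t ht => (hsub ht).1.ne'
    have := q.continuous
    exact ContinuousOn.intervalIntegrable_of_Icc huv (by fun_prop)
  have hodd : oddKernel (fun t => p.eval t) = fun t =>
      Complex.exp (Complex.I * p.eval t) * (t⁻¹ : ℝ) -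
        Complex.exp (Complex.I * (p.comp (-Polynomial.X)).eval t) * (t⁻¹ : ℝ) := by
    ext t
    simp [oddKernel, sub_mul, div_eq_mul_inv]
  rw [hodd, intervalIntegral.integral_sub (hint p) (hint _)]
  have hneg := norm_integral_exp_eval_mul_inv_le (p := p.comp (-Polynomial.X)) (N := N) hj
    (by rwa [natDegree_comp_neg_X]) (by simpa [coeff_comp_neg_X] using hpj) huv
    (by rwa [dominantSet_comp_neg_X]) (by simpa [coeff_comp_neg_X, abs_mul] using hu)
  refine (norm_sub_le _ _).trans ?_
  linarith [norm_integral_exp_eval_mul_inv_le hj hN hpj huv hsub hu]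

theorem norm_setIntegral_oddKernel_eval_le_of_one_le (hj : j ≠ 0)
    (hN : 4 * (p.natDegree : ℝ) ^ 3 ≤ N) (hpj : p.coeff j ≠ 0) {w : ℝ} (hw : 0 < w)
    (hwj : 1 ≤ |p.coeff j| * w ^ j) (b : ℝ) :
    ‖∫ t in dominantSet p N j ∩ Icc w b, oddKernel (fun t => p.eval t) t‖ ≤ 24 := by
  rcases (dominantSet p N j ∩ Icc w b).eq_empty_or_nonempty with hempty | hne
  · simp [hempty]
  have hord : (dominantSet p N j ∩ Icc w b).OrdConnected :=
    (ordConnected_dominantSet (le_trans (by positivity) hN)).inter ordConnected_Icc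
  obtain ⟨u, v, huv, hIcc⟩ : ∃ u v, u ≤ v ∧ dominantSet p N j ∩ Icc w b = Icc u v := by
    have h := eq_Icc_of_connected_compact ⟨hne, hord.isPreconnected⟩
      (isCompact_dominantSet_inter_Icc hw b)
    exact ⟨_, _, nonempty_Icc.1 (h ▸ hne), h⟩
  have hwu : w ≤ u := (hIcc.ge (left_mem_Icc.2 huv)).2.1
  rw [hIcc, integral_Icc_eq_integral_Ioc, ← intervalIntegral.integral_of_le huv]
  refine norm_intervalIntegral_oddKernel_eval_le hj hN hpj huv
    (hIcc.ge.trans inter_subset_left) (hwj.trans ?_)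
  gcongr

theorem norm_setIntegral_oddKernel_eval_dominantSet_le (hj : j ≠ 0)
    (hN : 4 * (p.natDegree : ℝ) ^ 3 ≤ N) (hpj : p.coeff j ≠ 0) (b : ℝ) :
    ‖∫ t in Ioc 0 b ∩ dominantSet p N j, oddKernel (fun t => p.eval t) t‖ ≤ 27 := by
  have hA := abs_pos.2 hpj
  obtain ⟨w, hw, hwj⟩ : ∃ w > 0, |p.coeff j| * w ^ j = 1 :=
    ⟨|p.coeff j|⁻¹ ^ (j : ℝ)⁻¹, by positivity, by
      rw [Real.rpow_inv_natCast_pow (by positivity) hj, mul_inv_cancel₀ hA.ne']⟩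
  have hmeas := measurableSet_dominantSet (p := p) (j := j) (le_trans (by positivity) hN)
  have hsplit : (Ioc 0 b ∩ dominantSet p N j) \ Iio w = dominantSet p N j ∩ Icc w b := by
    ext t
    simp only [Set.mem_sdiff, mem_inter_iff, mem_Ioc, mem_Iio, not_lt, mem_Icc]
    exact ⟨fun h => ⟨h.1.2, h.2, h.1.1.2⟩, fun h => ⟨⟨⟨h.1.1, h.2.2⟩, h.1⟩, h.2.1⟩⟩
  rw [← integral_inter_add_sdiff (measurableSet_Iio (a := w))
    ((integrableOn_oddKernel_eval p b).mono_set inter_subset_left), hsplit]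
  have hsmall := norm_setIntegral_oddKernel_eval_le_of_le_one hj hN hw.le hwj.le
    ((measurableSet_Ioc.inter hmeas).inter measurableSet_Iio)
    fun t (ht : t ∈ Ioc 0 b ∩ dominantSet p N j ∩ Iio w) => ⟨ht.1.2, ht.1.1.1, ht.2.le⟩
  have hlarge := norm_setIntegral_oddKernel_eval_le_of_one_le hj hN hpj hw hwj.ge b
  exact (norm_add_le _ _).trans (by linarith)

/-- The set of `t > 0` at which the monomial of degree `j` of `p` exceeds that of degree `i` by a
factor between `1` and `N`. -/
def comparableSet (p : ℝ[X]) (N : ℝ) (i j : ℕ) : Set ℝ :=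
  {t | 0 < t ∧ |p.coeff i| * t ^ i ≤ |p.coeff j| * t ^ j ∧
    |p.coeff j| * t ^ j ≤ N * (|p.coeff i| * t ^ i)}

theorem le_mul_of_pow_mul_pow_le {s t : ℝ} {i j : ℕ} (hs : 0 < s) (hst : s ≤ t) (hij : i < j)
    (h : s ^ i * t ^ j ≤ N * (s ^ j * t ^ i)) : t ≤ N * s := by
  obtain ⟨e, rfl⟩ := Nat.exists_eq_add_of_lt hij
  have ht : 0 < t := hs.trans_le hst
  have hcancel : t ^ (e + 1) ≤ N * s ^ (e + 1) :=
    le_of_mul_le_mul_left (by linear_combination h) (by positivity : 0 < s ^ i * t ^ i)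
  refine le_of_mul_le_mul_left ?_ (pow_pos hs e)
  calc s ^ e * t ≤ t ^ e * t := by gcongr
    _ = t ^ (e + 1) := (pow_succ t e).symm
    _ ≤ s ^ e * (N * s) := by linear_combination hcancel

theorem le_mul_of_mem_comparableSet {i : ℕ} (hij : i ≠ j) (hi : p.coeff i ≠ 0)
    (hj : p.coeff j ≠ 0) {s t : ℝ} (hs : s ∈ comparableSet p N i j)
    (ht : t ∈ comparableSet p N i j) (hst : s ≤ t) : t ≤ N * s := by
  have hs0 : 0 < s := hs.1
  have ht0 : 0 < t := ht.1
  have hij0 : 0 < |p.coeff i| * |p.coeff j| := mul_pos (abs_pos.2 hi) (abs_pos.2 hj)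
  rcases lt_or_gt_of_ne hij with h | h
  · refine le_mul_of_pow_mul_pow_le hs0 hst h (le_of_mul_le_mul_left ?_ hij0)
    have := mul_le_mul hs.2.1 ht.2.2 (by positivity) (by positivity)
    linear_combination this
  · refine le_mul_of_pow_mul_pow_le hs0 hst h (le_of_mul_le_mul_left ?_ hij0)
    have := mul_le_mul ht.2.1 hs.2.2 (by positivity) (by positivity)
    linear_combination this

theorem setLIntegral_comparableSet_le {i : ℕ} (hN : 1 ≤ N) (hij : i ≠ j) (hi : p.coeff i ≠ 0)
    (hj : p.coeff j ≠ 0) :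
    ∫⁻ t in comparableSet p N i j, ENNReal.ofReal (2 / t) ≤ ENNReal.ofReal (4 * N) := by
  rcases (comparableSet p N i j).eq_empty_or_nonempty with hempty | ⟨s, hs⟩
  · simp [hempty]
  have hs0 : 0 < s := hs.1
  have hN0 : 0 < N := one_pos.trans_le hN
  have hle : s / N ≤ N * s := (div_le_self hs0.le hN).trans (le_mul_of_one_le_left hs0.le hN)
  have hsub : comparableSet p N i j ⊆ Icc (s / N) (N * s) := fun t ht => by
    rw [mem_Icc, div_le_iff₀' hN0]
    rcases le_total s t with hst | hts
    · exact ⟨hst.trans (le_mul_of_one_le_left ht.1.le hN),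
        le_mul_of_mem_comparableSet hij hi hj hs ht hst⟩
    · exact ⟨le_mul_of_mem_comparableSet hij hi hj ht hs hts,
        hts.trans (le_mul_of_one_le_left hs0.le hN)⟩
  have hpos : ∀ t ∈ Icc (s / N) (N * s), 0 < t := fun t ht => (div_pos hs0 hN0).trans_le ht.1
  have hint : IntegrableOn (fun t : ℝ => 2 / t) (Icc (s / N) (N * s)) :=
    (continuousOn_const.div continuousOn_id fun t ht => (hpos t ht).ne').integrableOn_Icc
  refine (lintegral_mono_set hsub).trans ?_
  rw [← ofReal_integral_eq_lintegral_ofReal hint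
    ((ae_restrict_mem measurableSet_Icc).mono fun t ht => (div_pos two_pos (hpos t ht)).le)]
  refine ENNReal.ofReal_le_ofReal ?_
  rw [integral_Icc_eq_integral_Ioc, ← intervalIntegral.integral_of_le hle]
  simp_rw [div_eq_mul_inv (2 : ℝ)]
  rw [intervalIntegral.integral_const_mul, integral_inv_of_pos (by positivity) (by positivity),
    show N * s / (s / N) = N * N by field_simp, Real.log_mul hN0.ne' hN0.ne']
  linarith [Real.log_le_self hN0.le]

theorem exists_mem_dominantSet_or_comparableSet (hp : p.natDegree ≠ 0) (N : ℝ) {t : ℝ}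
    (ht : 0 < t) : (∃ j ∈ p.support.erase 0, t ∈ dominantSet p N j) ∨
      ∃ ij ∈ (p.support.erase 0).offDiag, t ∈ comparableSet p N ij.1 ij.2 := by
  have hmem : ∀ {i}, i ∈ p.support.erase 0 ↔ i ≠ 0 ∧ p.coeff i ≠ 0 := by simp
  have hne : (p.support.erase 0).Nonempty :=
    ⟨p.natDegree, hmem.2 ⟨hp, Polynomial.leadingCoeff_ne_zero.2 fun h => hp (by simp [h])⟩⟩
  obtain ⟨j, hj, hmax⟩ := Finset.exists_max_image _ (fun i => |p.coeff i| * t ^ i) hne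
  by_cases hdom : t ∈ dominantSet p N j
  · exact Or.inl ⟨j, hj, hdom⟩
  · simp only [dominantSet, mem_ofPred_eq, ht, true_and, not_forall, not_le] at hdom
    obtain ⟨i, hi0, hij, hlt⟩ := hdom
    have hi : i ∈ p.support.erase 0 := hmem.2 ⟨hi0, fun h => by
      rw [h, abs_zero, zero_mul, mul_zero] at hlt
      exact hlt.not_ge (by positivity)⟩
    exact Or.inr ⟨(i, j), Finset.mem_offDiag.2 ⟨hi, hj, hij⟩, ht, hmax i hi, hlt.le⟩

theorem pairwiseDisjoint_dominantSet (hN : 1 < N) :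
    (p.support.erase 0 : Set ℕ).PairwiseDisjoint (dominantSet p N) := by
  intro i hi j hj hij
  simp only [Finset.coe_erase, Set.mem_sdiff, Finset.mem_coe, Polynomial.mem_support_iff,
    mem_singleton_iff] at hi hj
  refine Set.disjoint_left.2 fun t hti htj => ?_
  have hit := mul_pos (abs_pos.2 hi.1) (pow_pos hti.1 i)
  have hjt := mul_pos (abs_pos.2 hj.1) (pow_pos hti.1 j)
  nlinarith [hti.2 j hj.2 hij.symm, htj.2 i hi.2 hij]

theorem card_support_erase_zero_le (p : ℝ[X]) : (p.support.erase 0).card ≤ p.natDegree := by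
  have hcard : (Finset.Icc 1 p.natDegree).card = p.natDegree := by simp
  refine (Finset.card_le_card fun i hi => ?_).trans_eq hcard
  rw [Finset.mem_erase, Polynomial.mem_support_iff] at hi
  exact Finset.mem_Icc.2
    ⟨Nat.one_le_iff_ne_zero.2 hi.1, Polynomial.le_natDegree_of_ne_zero hi.2⟩

theorem setLIntegral_biUnion_finset_le {ι α : Type*} [MeasurableSpace α] (μ : Measure α)
    (s : Finset ι) (t : ι → Set α) (f : α → ENNReal) :
    ∫⁻ x in ⋃ i ∈ s, t i, f x ∂μ ≤ ∑ i ∈ s, ∫⁻ x in t i, f x ∂μ := by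
  rw [← Finset.tsum_subtype s fun i => ∫⁻ x in t i, f x ∂μ]
  have h : ⋃ i ∈ s, t i = ⋃ i : s, t i := biUnion_eq_iUnion (s : Set ι) fun i _ => t i
  rw [h]
  exact lintegral_iUnion_le _ _

theorem norm_setIntegral_oddKernel_eval_biUnion_dominantSet_le
    (hN : 4 * (p.natDegree : ℝ) ^ 3 ≤ N) (hN1 : 1 < N) (b : ℝ) :
    ‖∫ t in Ioc 0 b ∩ ⋃ j ∈ p.support.erase 0, dominantSet p N j,
      oddKernel (fun t => p.eval t) t‖ ≤ 27 * p.natDegree := by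
  have hint := integrableOn_oddKernel_eval p b
  rw [inter_iUnion₂, integral_biUnion_finset _
    (fun j _ => measurableSet_Ioc.inter (measurableSet_dominantSet (by linarith)))
    ((pairwiseDisjoint_dominantSet hN1).mono fun j => inter_subset_right)
    (fun j _ => hint.mono_set inter_subset_left)]
  refine (norm_sum_le _ _).trans ?_
  calc _ ≤ (p.support.erase 0).card • (27 : ℝ) := Finset.sum_le_card_nsmul _ _ _ fun j hj => by
        rw [Finset.mem_erase, Polynomial.mem_support_iff] at hj
        exact norm_setIntegral_oddKernel_eval_dominantSet_le hj.1 hN hj.2 b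
    _ ≤ 27 * p.natDegree := by
        rw [nsmul_eq_mul, mul_comm]
        gcongr
        exact card_support_erase_zero_le p

theorem norm_setIntegral_oddKernel_eval_diff_dominantSet_le (hp : p.natDegree ≠ 0) (hN : 1 ≤ N)
    (b : ℝ) :
    ‖∫ t in Ioc 0 b \ ⋃ j ∈ p.support.erase 0, dominantSet p N j,
      oddKernel (fun t => p.eval t) t‖ ≤ p.natDegree ^ 2 * (4 * N) := by
  set S := p.support.erase 0
  set E := Ioc 0 b \ ⋃ j ∈ S, dominantSet p N j
  have hE : MeasurableSet E := measurableSet_Ioc.diff <|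
    S.measurableSet_biUnion fun j _ => measurableSet_dominantSet (by linarith)
  have hcover : E ⊆ ⋃ ij ∈ S.offDiag, comparableSet p N ij.1 ij.2 := fun t ht => by
    rcases exists_mem_dominantSet_or_comparableSet hp N ht.1.1 with ⟨j, hj, hjt⟩ | ⟨ij, hij, hijt⟩
    · exact absurd (mem_biUnion hj hjt) ht.2
    · exact mem_biUnion hij hijt
  have hcomparable : ∀ ij ∈ S.offDiag,
      ∫⁻ t in comparableSet p N ij.1 ij.2, ENNReal.ofReal (2 / t) ≤ ENNReal.ofReal (4 * N) :=
    fun ij hij => by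
      simp only [S, Finset.mem_offDiag, Finset.mem_erase, Polynomial.mem_support_iff] at hij
      exact setLIntegral_comparableSet_le hN hij.2.2 hij.1.2 hij.2.1.2
  have hcard : S.offDiag.card ≤ p.natDegree ^ 2 := by
    rw [Finset.offDiag_card, sq]
    exact (Nat.sub_le _ _).trans
      (Nat.mul_le_mul (card_support_erase_zero_le p) (card_support_erase_zero_le p))
  have henorm : ‖∫ t in E, oddKernel (fun t => p.eval t) t‖ₑ
      ≤ ENNReal.ofReal (S.offDiag.card * (4 * N)) := by
    calc _ ≤ ∫⁻ t in E, ‖oddKernel (fun t => p.eval t) t‖ₑ := enorm_integral_le_lintegral_enorm _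
      _ ≤ ∫⁻ t in E, ENNReal.ofReal (2 / t) := setLIntegral_mono' hE fun t ht => by
          rw [← ofReal_norm]
          exact ENNReal.ofReal_le_ofReal (norm_oddKernel_le _ ht.1.1)
      _ ≤ ∫⁻ t in ⋃ ij ∈ S.offDiag, comparableSet p N ij.1 ij.2, ENNReal.ofReal (2 / t) :=
          lintegral_mono_set hcover
      _ ≤ ∑ ij ∈ S.offDiag, ∫⁻ t in comparableSet p N ij.1 ij.2, ENNReal.ofReal (2 / t) :=
          setLIntegral_biUnion_finset_le _ _ _ _
      _ ≤ S.offDiag.card • ENNReal.ofReal (4 * N) := Finset.sum_le_card_nsmul _ _ _ hcomparable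
      _ = ENNReal.ofReal (S.offDiag.card * (4 * N)) := by
          rw [nsmul_eq_mul, ENNReal.ofReal_mul (Nat.cast_nonneg _), ENNReal.ofReal_natCast]
  rw [← ofReal_norm, ENNReal.ofReal_le_ofReal_iff (by positivity)] at henorm
  refine henorm.trans ?_
  gcongr
  exact_mod_cast hcard

theorem norm_setIntegral_oddKernel_eval_le (p : ℝ[X]) (b : ℝ) :
    ‖∫ t in Ioc 0 b, oddKernel (fun t => p.eval t) t‖ ≤ 51 * ((p.natDegree : ℝ) + 1) ^ 5 := by
  by_cases hp : p.natDegree = 0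
  · have hconst : oddKernel (fun t => p.eval t) = 0 := by
      ext t
      rw [Polynomial.eq_C_of_natDegree_eq_zero hp]
      simp [oddKernel]
    simp only [hconst, Pi.zero_apply, integral_zero, norm_zero]
    positivity
  have hd : (0 : ℝ) ≤ (p.natDegree : ℝ) ^ 3 := by positivity
  have hmeas : MeasurableSet
      (⋃ j ∈ p.support.erase 0, dominantSet p (4 * (p.natDegree : ℝ) ^ 3 + 2) j) :=
    Finset.measurableSet_biUnion _ fun j _ => measurableSet_dominantSet (by positivity)
  rw [← integral_inter_add_sdiff hmeas (integrableOn_oddKernel_eval p b)]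
  refine (norm_add_le _ _).trans ((add_le_add
    (norm_setIntegral_oddKernel_eval_biUnion_dominantSet_le (by linarith) (by linarith) b)
    (norm_setIntegral_oddKernel_eval_diff_dominantSet_le hp (by linarith) b)).trans ?_)
  have hexpand : 51 * ((p.natDegree : ℝ) + 1) ^ 5 = 27 * p.natDegree +
      p.natDegree ^ 2 * (4 * (4 * (p.natDegree : ℝ) ^ 3 + 2)) + (35 * (p.natDegree : ℝ) ^ 5 +
        255 * p.natDegree ^ 4 + 510 * p.natDegree ^ 3 + 502 * p.natDegree ^ 2 +
        228 * p.natDegree + 51) := by ring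
  rw [hexpand]
  exact le_add_of_nonneg_right (by positivity)

end PolynomialPhase

section PrincipalValue

theorem uniqueDiffOn_I : UniqueDiffOn ℝ I := uniqueDiffOn_Icc (by norm_num)

theorem mem_I_of_mem_Ioc {t : ℝ} (ht : t ∈ Ioc (0 : ℝ) 1) : t ∈ I ∧ -t ∈ I := by
  have h1 := ht.1
  have h2 := ht.2
  exact ⟨⟨by linarith, h2⟩, ⟨by linarith, by linarith⟩⟩

variable {M : ℕ → ℝ} {ψ : ℝ → ℝ}

theorem DenjoyCarleman.exists_abs_sub_neg_le (hψ : DenjoyCarleman M ψ) :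
    ∃ C, ∀ t ∈ Ioc (0 : ℝ) 1, |ψ t - ψ (-t)| ≤ C * t := by
  obtain ⟨hs, K, -, hb⟩ := hψ
  refine ⟨K ^ 2 * M 1 * 2, fun t ht => ?_⟩
  obtain ⟨h1, h2⟩ := mem_I_of_mem_Ioc ht
  have hd : DifferentiableOn ℝ ψ I := hs.differentiableOn (by simp)
  have := Convex.norm_image_sub_le_of_norm_derivWithin_le (C := K ^ 2 * M 1) hd (fun x hx => by
    have := hb 1 x hx
    rwa [iteratedDerivWithin_one] at this) (convex_Icc (-1 : ℝ) 1) h2 h1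
  rw [Real.norm_eq_abs, Real.norm_eq_abs] at this
  refine this.trans_eq ?_
  rw [sub_neg_eq_add, abs_of_pos (by have := ht.1; linarith)]
  ring

theorem DenjoyCarleman.integrableOn_oddKernel (hψ : DenjoyCarleman M ψ) (lam : ℝ) :
    IntegrableOn (oddKernel fun t => lam * ψ t) (Ioc 0 1) := by
  obtain ⟨C, hC⟩ := hψ.exists_abs_sub_neg_le
  refine SteinWainger.integrableOn_oddKernel (C := |lam| * C)
    (continuousOn_const.mul hψ.1.continuousOn) fun t ht => ?_
  rw [← mul_sub, abs_mul, mul_assoc]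
  gcongr
  exact hC t ht

theorem truncated_eq_integral_oddKernel (hψ : ContinuousOn ψ I) (lam : ℝ) {ε : ℝ} (h0 : 0 < ε)
    (h1 : ε ≤ 1) :
    truncated ψ lam ε = ∫ t in ε..1, oddKernel (fun t => lam * ψ t) t := by
  have hc : ∀ χ : ℝ → ℝ, ContinuousOn χ (Icc ε 1) → IntervalIntegrable
      (fun t : ℝ => Complex.exp (Complex.I * lam * χ t) / t) volume ε 1 := fun χ hχ => by
    refine ContinuousOn.intervalIntegrable ?_
    rw [uIcc_of_le h1]
    have := Complex.continuous_ofReal.comp_continuousOn hχ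
    refine ContinuousOn.div (continuousOn_const.mul this).cexp (by fun_prop) fun t ht => ?_
    exact_mod_cast (h0.trans_le ht.1).ne'
  have hpos : ContinuousOn ψ (Icc ε 1) := hψ.mono (Icc_subset_Icc (by linarith) le_rfl)
  have hneg : ContinuousOn (fun t => ψ (-t)) (Icc ε 1) := hψ.comp continuousOn_neg fun t ht =>
    ⟨by linarith [ht.2], by linarith [ht.1]⟩
  have hrefl : ∫ t in (-1 : ℝ)..(-ε), Complex.exp (Complex.I * lam * ψ t) / t
      = ∫ t in ε..1, -(Complex.exp (Complex.I * lam * ψ (-t)) / t) := by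
    rw [← intervalIntegral.integral_comp_neg]
    refine intervalIntegral.integral_congr fun t _ => ?_
    simp [div_neg]
  rw [truncated, hrefl, intervalIntegral.integral_neg, neg_add_eq_sub,
    ← intervalIntegral.integral_sub (hc _ hpos) (hc _ hneg)]
  refine intervalIntegral.integral_congr fun t _ => ?_
  simp only [oddKernel, Complex.ofReal_mul, mul_assoc]
  ring

theorem DenjoyCarleman.hasPrincipalValue (hψ : DenjoyCarleman M ψ) (lam : ℝ) :
    HasPrincipalValue ψ lam (∫ t in Ioc 0 1, oddKernel (fun t => lam * ψ t) t) := by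
  have hint := hψ.integrableOn_oddKernel lam
  have hc := intervalIntegral.continuousOn_primitive_interval_left (μ := volume)
    (f := oddKernel fun t => lam * ψ t) (a := 0) (b := 1)
    (by rwa [uIcc_of_le zero_le_one, integrableOn_Icc_iff_integrableOn_Ioc])
  have h0 := hc 0 (by simp)
  rw [uIcc_of_le zero_le_one] at h0
  have h1 : Tendsto (fun ε => ∫ t in ε..1, oddKernel (fun t => lam * ψ t) t) (𝓝[>] 0)
      (𝓝 (∫ t in (0 : ℝ)..1, oddKernel (fun t => lam * ψ t) t)) := by
    refine h0.mono_left ?_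
    rw [← nhdsWithin_Ioc_eq_nhdsGT (zero_lt_one (α := ℝ))]
    exact nhdsWithin_mono _ Ioc_subset_Icc_self
  rw [← intervalIntegral.integral_of_le zero_le_one]
  refine h1.congr' ?_
  filter_upwards [Ioc_mem_nhdsGT (zero_lt_one (α := ℝ))] with ε hε
  exact (truncated_eq_integral_oddKernel hψ.1.continuousOn lam hε.1 hε.2).symm

theorem DenjoyCarleman.m_eq (hψ : DenjoyCarleman M ψ) (lam : ℝ) :
    m ψ lam = ∫ t in Ioc 0 1, oddKernel (fun t => lam * ψ t) t :=
  (hψ.hasPrincipalValue lam).limUnder_eq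

end PrincipalValue

section Taylor

/-- The Taylor polynomial of degree `n` at `0` of a function on `[-1, 1]`. -/
def taylorPolynomial (ψ : ℝ → ℝ) (n : ℕ) : ℝ[X] :=
  ∑ i ∈ Finset.range (n + 1),
    Polynomial.C ((i.factorial : ℝ)⁻¹ * iteratedDerivWithin i ψ I 0) * Polynomial.X ^ i

theorem natDegree_taylorPolynomial_le (ψ : ℝ → ℝ) (n : ℕ) :
    (taylorPolynomial ψ n).natDegree ≤ n :=
  Polynomial.natDegree_sum_le_of_forall_le _ _ fun _ hi =>
    (Polynomial.natDegree_C_mul_X_pow_le _ _).trans (Finset.mem_range_succ_iff.1 hi)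

variable {M : ℕ → ℝ} {ψ : ℝ → ℝ} {n : ℕ} {R : ℝ}

theorem iteratedDerivWithin_uIcc_eq (hψ : ContDiffOn ℝ ∞ ψ I) {t : ℝ} (ht : t ∈ I) (hne : 0 ≠ t)
    (i : ℕ) {x : ℝ} (hx : x ∈ uIcc 0 t) :
    iteratedDerivWithin i ψ (uIcc 0 t) x = iteratedDerivWithin i ψ I x := by
  have hsub : uIcc 0 t ⊆ I := uIcc_subset_Icc (by norm_num) ht
  rw [iteratedDerivWithin, iteratedDerivWithin, iteratedFDerivWithin_subset hsub
    (uniqueDiffOn_Icc (by simpa using hne.symm)) uniqueDiffOn_I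
    (hψ.of_le (by exact_mod_cast le_top)) hx]

theorem eval_taylorPolynomial (hψ : ContDiffOn ℝ ∞ ψ I) {t : ℝ} (ht : t ∈ I) (hne : 0 ≠ t) :
    (taylorPolynomial ψ n).eval t = taylorWithinEval ψ n (uIcc 0 t) 0 t := by
  rw [taylor_within_apply, taylorPolynomial, Polynomial.eval_finsetSum]
  refine Finset.sum_congr rfl fun i _ => ?_
  rw [iteratedDerivWithin_uIcc_eq hψ ht hne i left_mem_uIcc, sub_zero, smul_eq_mul,
    Polynomial.eval_C_mul, Polynomial.eval_X_pow]
  ring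

theorem abs_sub_eval_taylorPolynomial_le (hψ : ContDiffOn ℝ ∞ ψ I)
    (hR : ∀ t ∈ I, |iteratedDerivWithin (n + 1) ψ I t| ≤ R) {t : ℝ} (ht : t ∈ I) :
    |ψ t - (taylorPolynomial ψ n).eval t| ≤ R * |t| ^ (n + 1) := by
  rcases eq_or_ne 0 t with rfl | hne
  · simp [taylorPolynomial, Polynomial.eval_finsetSum, Finset.sum_range_succ']
  have hsub : uIcc 0 t ⊆ I := uIcc_subset_Icc (by norm_num) ht
  have hψt := hψ.mono hsub
  have hud : UniqueDiffOn ℝ (uIcc 0 t) := uniqueDiffOn_Icc (by simpa using hne.symm)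
  obtain ⟨x, hx, hremainder⟩ := taylor_mean_remainder_lagrange (n := n) hne
    (hψt.of_le (by exact_mod_cast le_top))
    ((hψt.differentiableOn_iteratedDerivWithin (by exact_mod_cast WithTop.coe_lt_top _) hud).mono
      uIoo_subset_uIcc_self)
  have hx' := uIoo_subset_uIcc_self hx
  rw [iteratedDerivWithin_uIcc_eq hψ ht hne _ hx', sub_zero] at hremainder
  rw [eval_taylorPolynomial hψ ht hne, hremainder, abs_div, abs_mul, abs_pow, Nat.abs_cast]
  refine (div_le_self (by positivity)
    (by exact_mod_cast Nat.succ_le_of_lt (Nat.factorial_pos _))).trans ?_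
  gcongr
  exact hR x (hsub hx')

theorem norm_setIntegral_oddKernel_sub_taylorPolynomial_le (hψ : ContDiffOn ℝ ∞ ψ I)
    (hR0 : 0 ≤ R) (hR : ∀ t ∈ I, |iteratedDerivWithin (n + 1) ψ I t| ≤ R) {lam ε : ℝ}
    (hlam : 0 ≤ lam) (h0 : 0 < ε) (h1 : ε ≤ 1) :
    ‖∫ t in Ioc 0 ε, (oddKernel (fun t => lam * ψ t) t -
      oddKernel (fun t => (Polynomial.C lam * taylorPolynomial ψ n).eval t) t)‖
      ≤ 2 * lam * R * ε ^ (n + 1) := by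
  refine (norm_setIntegral_le_of_norm_le_const (C := 2 * lam * R * ε ^ n) (by simp)
    fun t ht => ?_).trans_eq ?_
  · have ht0 : 0 < t := ht.1
    obtain ⟨hpos, hneg⟩ := mem_I_of_mem_Ioc ⟨ht0, ht.2.trans h1⟩
    have htaylor : ∀ s ∈ I, |s| = t →
        |lam * ψ s - (Polynomial.C lam * taylorPolynomial ψ n).eval s| ≤ lam * (R * t ^ (n + 1)) :=
      fun s hs hst => by
        rw [Polynomial.eval_C_mul, ← mul_sub, abs_mul, abs_of_nonneg hlam, ← hst]
        gcongr
        exact abs_sub_eval_taylorPolynomial_le hψ hR hs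
    refine (norm_oddKernel_sub_le _ _ ht0).trans ?_
    rw [div_le_iff₀ ht0]
    calc _ ≤ lam * (R * t ^ (n + 1)) + lam * (R * t ^ (n + 1)) :=
          add_le_add (htaylor t hpos (abs_of_pos ht0))
            (htaylor (-t) hneg ((abs_neg t).trans (abs_of_pos ht0)))
      _ = 2 * lam * R * t ^ n * t := by ring
      _ ≤ 2 * lam * R * ε ^ n * t := by gcongr; exact ht.2
  · simp only [measureReal_def, Real.volume_Ioc, sub_zero, ENNReal.toReal_ofReal h0.le]
    ring

theorem norm_setIntegral_oddKernel_Ioc_le (φ : ℝ → ℝ) {ε : ℝ} (h0 : 0 < ε) (h1 : ε ≤ 1) :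
    ‖∫ t in Ioc ε 1, oddKernel φ t‖ ≤ 2 * Real.log ε⁻¹ := by
  have hc : ContinuousOn (fun t : ℝ => 2 * t⁻¹) (Icc ε 1) :=
    continuousOn_const.mul (continuousOn_id.inv₀ fun t ht => (h0.trans_le ht.1).ne')
  calc _ ≤ ∫ t in Ioc ε 1, 2 * t⁻¹ := by
        refine norm_integral_le_of_norm_le (hc.integrableOn_Icc.mono_set Ioc_subset_Icc_self) ?_
        refine (ae_restrict_mem measurableSet_Ioc).mono fun t ht => ?_
        rw [← div_eq_mul_inv]
        exact norm_oddKernel_le φ (h0.trans ht.1)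
    _ = 2 * Real.log ε⁻¹ := by
        rw [← intervalIntegral.integral_of_le h1, intervalIntegral.integral_const_mul,
          integral_inv_of_pos h0 one_pos, one_div]

theorem DenjoyCarleman.norm_m_le (hψ : DenjoyCarleman M ψ) (hR0 : 0 ≤ R)
    (hR : ∀ t ∈ I, |iteratedDerivWithin (n + 1) ψ I t| ≤ R) {lam ε : ℝ} (hlam : 0 ≤ lam)
    (h0 : 0 < ε) (h1 : ε ≤ 1) :
    ‖m ψ lam‖ ≤ 2 * Real.log ε⁻¹ + 2 * lam * R * ε ^ (n + 1) + 51 * ((n : ℝ) + 1) ^ 5 := by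
  set p := Polynomial.C lam * taylorPolynomial ψ n
  have hint := hψ.integrableOn_oddKernel lam
  have hint0 : IntegrableOn (oddKernel fun t => lam * ψ t) (Ioc 0 ε) :=
    hint.mono_set (Ioc_subset_Ioc le_rfl h1)
  have hsplit : m ψ lam = (∫ t in Ioc 0 ε,
      (oddKernel (fun t => lam * ψ t) t - oddKernel (fun t => p.eval t) t)) +
      (∫ t in Ioc 0 ε, oddKernel (fun t => p.eval t) t) +
        ∫ t in Ioc ε 1, oddKernel (fun t => lam * ψ t) t := by
    rw [integral_sub hint0 (integrableOn_oddKernel_eval p ε), sub_add_cancel, hψ.m_eq,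
      ← setIntegral_union (Ioc_disjoint_Ioc_of_le le_rfl) measurableSet_Ioc hint0
        (hint.mono_set (Ioc_subset_Ioc h0.le le_rfl)), Ioc_union_Ioc_eq_Ioc h0.le h1]
  have hpoly : ‖∫ t in Ioc 0 ε, oddKernel (fun t => p.eval t) t‖ ≤ 51 * ((n : ℝ) + 1) ^ 5 := by
    refine (norm_setIntegral_oddKernel_eval_le p ε).trans ?_
    gcongr
    exact (Polynomial.natDegree_C_mul_le _ _).trans (natDegree_taylorPolynomial_le ψ n)
  have htaylor := norm_setIntegral_oddKernel_sub_taylorPolynomial_le hψ.1 hR0 hR hlam h0 h1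
  have htail := norm_setIntegral_oddKernel_Ioc_le (fun t => lam * ψ t) h0 h1
  rw [hsplit]
  exact norm_add₃_le.trans (by linarith)

end Taylor

section IteratedLog

theorem tendsto_iterate_log_atTop (j : ℕ) : Tendsto Real.log^[j] atTop atTop := by
  induction j with
  | zero => exact tendsto_id
  | succ j ih =>
    rw [Function.iterate_succ']
    exact Real.tendsto_log_atTop.comp ih

/-- The condition on the argument of the logarithms of the flat phase: the first `k` iterated
logarithms of `x` are at least `2`. Positivity of `x` is added because `Real.log` is even. -/
def LogsGeTwo (k : ℕ) (x : ℝ) : Prop :=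
  0 < x ∧ ∀ j, 1 ≤ j → j ≤ k → 2 ≤ Real.log^[j] x

theorem eventually_logsGeTwo (k : ℕ) : ∀ᶠ x in atTop, LogsGeTwo k x := by
  have h : ∀ᶠ x in atTop, ∀ j ∈ Finset.Icc 1 k, 2 ≤ Real.log^[j] x :=
    (Finset.Icc 1 k).eventually_all.2 fun j _ =>
      (tendsto_iterate_log_atTop j).eventually_ge_atTop 2
  filter_upwards [eventually_gt_atTop 0, h] with x hx hlog
  exact ⟨hx, fun j h1 hj => hlog j (Finset.mem_Icc.2 ⟨h1, hj⟩)⟩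

namespace LogsGeTwo

variable {j k : ℕ} {x y : ℝ}

theorem iterate_log_pos (h : LogsGeTwo k x) (hj : j ≤ k) : 0 < Real.log^[j] x := by
  rcases Nat.eq_zero_or_pos j with rfl | hj0
  · exact h.1
  · exact two_pos.trans_le (h.2 j hj0 hj)

theorem iterate_log_le_iterate_log (h : LogsGeTwo k x) (hxy : x ≤ y) (hj : j ≤ k) :
    Real.log^[j] x ≤ Real.log^[j] y := by
  induction j with
  | zero => exact hxy
  | succ j ih =>
    simp only [Function.iterate_succ_apply']
    exact Real.log_le_log (h.iterate_log_pos (by omega)) (ih (by omega))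

theorem mono (h : LogsGeTwo k x) (hxy : x ≤ y) : LogsGeTwo k y :=
  ⟨h.1.trans_le hxy, fun j h1 hj => (h.2 j h1 hj).trans (h.iterate_log_le_iterate_log hxy hj)⟩

theorem iterate_log_le (h : LogsGeTwo k x) {i : ℕ} (hij : i ≤ j) (hj : j ≤ k) :
    Real.log^[j] x ≤ Real.log^[i] x := by
  induction j, hij using Nat.le_induction with
  | base => exact le_rfl
  | succ j _ ih =>
    rw [Function.iterate_succ_apply']
    exact (Real.log_le_self (h.iterate_log_pos (by omega)).le).trans (ih (by omega))

theorem iterate_exp_iterate_log (h : LogsGeTwo k x) {i : ℕ} (hj : j + i ≤ k) :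
    Real.exp^[j] (Real.log^[j + i] x) = Real.log^[i] x := by
  induction j with
  | zero => rw [zero_add, Function.iterate_zero, id]
  | succ j ih =>
    rw [Function.iterate_succ_apply, Nat.succ_add, Function.iterate_succ_apply',
      Real.exp_log (h.iterate_log_pos (by omega)), ih (by omega)]

end LogsGeTwo

theorem monotone_iterate_exp (j : ℕ) : Monotone Real.exp^[j] := Real.exp_monotone.iterate j

end IteratedLog

section UpperBound

theorem DenjoyCarleman.nonneg {M : ℕ → ℝ} {ψ : ℝ → ℝ} (hψ : DenjoyCarleman M ψ) (n : ℕ) :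
    0 ≤ M n := by
  obtain ⟨-, K, hK, hbound⟩ := hψ
  exact nonneg_of_mul_nonneg_right
    ((abs_nonneg _).trans (hbound n 0 (by simp [I]))) (pow_pos hK (n + 1))

theorem DenjoyCarleman.exists_norm_m_le {M : ℕ → ℝ} {ψ : ℝ → ℝ} (hψ : DenjoyCarleman M ψ) :
    ∃ C, ∀ (n : ℕ) (lam : ℝ), 1 ≤ lam → M (n + 1) ≤ lam →
      ‖m ψ lam‖ ≤ 4 * Real.log lam / (n + 1) + C + 51 * ((n : ℝ) + 1) ^ 5 := by
  obtain ⟨K₀, hK₀, hbound⟩ := hψ.2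
  set K := max K₀ 1
  have hK1 : 1 ≤ K := le_max_right _ _
  refine ⟨2 * Real.log K + 2 * K, fun n lam hlam1 hM => ?_⟩
  have hlam0 : 0 < lam := one_pos.trans_le hlam1
  have hM0 := hψ.nonneg (n + 1)
  set ε : ℝ := (lam ^ (2 / ((n : ℝ) + 1)) * K)⁻¹ with hε
  have hε0 : 0 < ε := by positivity
  have hε1 : ε ≤ 1 := inv_le_one_of_one_le₀ <|
    one_le_mul_of_one_le_of_one_le (Real.one_le_rpow hlam1 (by positivity)) hK1
  have hεpow : ε ^ (n + 1) = (lam ^ 2 * K ^ (n + 1))⁻¹ := by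
    rw [hε, inv_pow, mul_pow, ← Real.rpow_natCast (lam ^ _), ← Real.rpow_mul hlam0.le]
    push_cast
    rw [div_mul_cancel₀ _ (by positivity)]
    norm_num
  have hlogε : Real.log ε⁻¹ = 2 * Real.log lam / (n + 1) + Real.log K := by
    rw [hε, inv_inv, Real.log_mul (by positivity) (by positivity), Real.log_rpow hlam0]
    ring
  have hremainder : 2 * lam * (K ^ (n + 2) * M (n + 1)) * ε ^ (n + 1) ≤ 2 * K := by
    rw [hεpow, ← div_eq_mul_inv, div_le_iff₀ (by positivity)]
    calc _ ≤ 2 * lam * (K ^ (n + 2) * lam) := by gcongr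
      _ = 2 * K * (lam ^ 2 * K ^ (n + 1)) := by ring
  have hm := hψ.norm_m_le (n := n) (R := K ^ (n + 2) * M (n + 1)) (by positivity)
    (fun t ht => (hbound (n + 1) t ht).trans (by gcongr; exact le_max_left _ _)) hlam0.le hε0 hε1
  rw [hlogε] at hm
  refine hm.trans ?_
  have : 2 * (2 * Real.log lam / (n + 1) + Real.log K)
      = 4 * Real.log lam / (n + 1) + 2 * Real.log K := by ring
  linarith

/-- The solution `x` of `exp^{(k)} (c x^α) = lam`: the order up to which the phase should be
expanded at frequency `lam`. -/
def criticalOrder (k : ℕ) (c α lam : ℝ) : ℝ :=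
  (Real.log^[k] lam / c) ^ (1 / α)

variable {k : ℕ} {c α : ℝ}

theorem tendsto_criticalOrder (k : ℕ) (hc : 0 < c) (hα : 0 < α) :
    Tendsto (criticalOrder k c α) atTop atTop :=
  (tendsto_rpow_atTop (by positivity)).comp ((tendsto_iterate_log_atTop k).atTop_div_const hc)

theorem weight_le_of_le_criticalOrder (hc : 0 < c) (hα : 0 < α) {lam : ℝ} (h : LogsGeTwo k lam)
    {n : ℕ} (hn : n ≤ criticalOrder k c α lam) : weight k c α n ≤ lam := by
  have hlog := h.iterate_log_pos le_rfl
  refine (monotone_iterate_exp k ?_).trans_eq (h.iterate_exp_iterate_log (i := 0) le_rfl)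
  rw [add_zero, ← le_div_iff₀' hc]
  calc (n : ℝ) ^ α ≤ criticalOrder k c α lam ^ α := by gcongr
    _ = Real.log^[k] lam / c := by
      rw [criticalOrder, ← Real.rpow_mul (by positivity), one_div_mul_cancel hα.ne', Real.rpow_one]

theorem eventually_criticalOrder_pow_six_le (hk : 2 ≤ k) (hc : 0 < c) (hα : 0 < α) :
    ∀ᶠ lam in atTop, criticalOrder k c α lam ^ 6 ≤ Real.log lam := by
  have hbound : ∀ᶠ y in atTop, ‖Real.log y ^ (6 / α)‖ ≤ c ^ (6 / α) * ‖y ^ (1 : ℝ)‖ :=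
    (isLittleO_log_rpow_rpow_atTop (6 / α) one_pos).bound (by positivity)
  filter_upwards [Real.tendsto_log_atTop.eventually hbound, eventually_logsGeTwo k] with lam hb h
  have h1 : 0 < Real.log lam := h.iterate_log_pos (j := 1) (by omega)
  have h2 : 0 < Real.log (Real.log lam) := h.iterate_log_pos (j := 2) hk
  have hk0 := h.iterate_log_pos le_rfl
  have hle : Real.log^[k] lam ≤ Real.log (Real.log lam) := h.iterate_log_le hk le_rfl
  rw [Real.rpow_one, Real.norm_of_nonneg h1.le, Real.norm_of_nonneg (by positivity)] at hb
  calc criticalOrder k c α lam ^ 6 = (Real.log^[k] lam / c) ^ (6 / α) := by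
        rw [criticalOrder, ← Real.rpow_natCast, ← Real.rpow_mul (by positivity)]
        congr 1
        push_cast
        ring
    _ ≤ (Real.log (Real.log lam) / c) ^ (6 / α) := by gcongr
    _ ≤ Real.log lam := by
        rwa [Real.div_rpow h2.le hc.le, div_le_iff₀ (by positivity), mul_comm]

theorem log_div_criticalOrder (hc : 0 < c) {lam : ℝ} (hlog : 0 < Real.log^[k] lam) :
    Real.log lam / criticalOrder k c α lam = c ^ (1 / α) * growth k α lam := by
  rw [growth, criticalOrder, Real.div_rpow hlog.le hc.le]
  field_simp

theorem DenjoyCarleman.m_isBigO_growth (hk : 2 ≤ k) (hc : 0 < c) (hα : 0 < α) {ψ : ℝ → ℝ}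
    (hψ : DenjoyCarleman (weight k c α) ψ) :
    (fun lam : ℝ => m ψ lam) =O[atTop] fun lam : ℝ => growth k α lam := by
  obtain ⟨C, hC⟩ := hψ.exists_norm_m_le
  refine IsBigO.of_bound ((59 + |C|) * c ^ (1 / α)) ?_
  filter_upwards [(tendsto_criticalOrder k hc hα).eventually_ge_atTop 1,
    eventually_criticalOrder_pow_six_le hk hc hα, eventually_logsGeTwo k, eventually_ge_atTop 1]
    with lam hX1 hX6 hlogs hlam1
  have hgrowth := log_div_criticalOrder (α := α) hc (hlogs.iterate_log_pos le_rfl)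
  have hweight := fun n => weight_le_of_le_criticalOrder (n := n) hc hα hlogs
  set X := criticalOrder k c α lam
  have hX0 : 0 < X := one_pos.trans_le hX1
  obtain ⟨n, hn⟩ : ∃ n, ⌊X⌋₊ = n + 1 :=
    Nat.exists_eq_add_one.2 ((Nat.one_le_floor_iff X).2 hX1)
  have hnX : (n : ℝ) + 1 ≤ X := by exact_mod_cast hn ▸ Nat.floor_le hX0.le
  have hXn : X < (n : ℝ) + 1 + 1 := by exact_mod_cast hn ▸ Nat.lt_floor_add_one X
  set G := Real.log lam / X with hG
  have hX5 : X ^ 5 ≤ G := by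
    rw [hG, le_div_iff₀ hX0]
    linarith
  have hG1 : 1 ≤ G := (one_le_pow₀ hX1).trans hX5
  have hlog : 4 * Real.log lam / (n + 1) ≤ 8 * G := by
    have hlog0 : 0 ≤ Real.log lam := Real.log_nonneg hlam1
    rw [hG, ← mul_div_assoc, div_le_div_iff₀ (by positivity) hX0]
    nlinarith [n.cast_nonneg (α := ℝ)]
  have hC1 : C ≤ |C| * G := (le_abs_self C).trans (le_mul_of_one_le_right (abs_nonneg C) hG1)
  have hpow : ((n : ℝ) + 1) ^ 5 ≤ G := (pow_le_pow_left₀ (by positivity) hnX 5).trans hX5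
  calc ‖m ψ lam‖ ≤ 4 * Real.log lam / (n + 1) + C + 51 * ((n : ℝ) + 1) ^ 5 :=
        hC n lam hlam1 (hweight _ (by exact_mod_cast hnX))
    _ ≤ (59 + |C|) * G := by linarith
    _ ≤ (59 + |C|) * c ^ (1 / α) * ‖growth k α lam‖ := by
        rw [hgrowth, mul_assoc]
        gcongr
        exact Real.le_norm_self _

end UpperBound

section ComplexExtension

/-- The decay `exp (-B log x (log^{(k)} x)^s)` of the flat phase in terms of `x = 1 / (δ t)`. -/
def logDecay (k : ℕ) (s B x : ℝ) : ℝ :=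
  Real.exp (-(B * Real.log x * Real.log^[k] x ^ s))

/-- The holomorphic extension of `logDecay`, with principal branches throughout. -/
def clogDecay (k : ℕ) (s B : ℝ) (z : ℂ) : ℂ :=
  Complex.exp (-(B * Complex.log z * Complex.log^[k] z ^ (s : ℂ)))

theorem flatPhase_of_pos (k : ℕ) (α B δ : ℝ) {t : ℝ} (ht : 0 < t) :
    flatPhase k α B δ t = logDecay k (1 / α) B (1 / (δ * t)) :=
  if_neg ht.not_ge

theorem norm_log_sub_log_le {z w : ℂ} (hz : 1 ≤ z.re) (hw : 1 ≤ w.re) :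
    ‖Complex.log z - Complex.log w‖ ≤ ‖z - w‖ := by
  have h := Convex.norm_image_sub_le_of_norm_hasDerivWithin_le (𝕜 := ℂ) (f := Complex.log)
    (f' := fun z => z⁻¹) (s := {z : ℂ | 1 ≤ z.re}) (C := 1) (x := w) (y := z)
    (fun x hx => (Complex.hasDerivAt_log (Or.inl (one_pos.trans_le hx))).hasDerivWithinAt)
    (fun x hx => by
      rw [norm_inv]
      exact inv_le_one_of_one_le₀ (le_trans hx (Complex.re_le_norm x)))
    (convex_halfSpace_re_ge 1) hw hz
  rwa [one_mul] at h

theorem one_le_re_of_norm_sub_le {a : ℝ} {z : ℂ} (ha : 2 ≤ a) (h : ‖z - a‖ ≤ 1) : 1 ≤ z.re := by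
  have hre := (abs_le.1 ((Complex.abs_re_le_norm _).trans h)).1
  rw [Complex.sub_re, Complex.ofReal_re] at hre
  linarith

variable {k j : ℕ} {s B x : ℝ} {z : ℂ}

theorem LogsGeTwo.ofReal_iterate_log (h : LogsGeTwo k x) (hj : j ≤ k) :
    ((Real.log^[j] x : ℝ) : ℂ) = Complex.log^[j] (x : ℂ) := by
  induction j with
  | zero => rfl
  | succ j ih =>
    rw [Function.iterate_succ_apply', Function.iterate_succ_apply',
      Complex.ofReal_log (h.iterate_log_pos (by omega)).le, ih (by omega)]

theorem clogDecay_ofReal (h : LogsGeTwo k x) (s B : ℝ) :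
    clogDecay k s B x = logDecay k s B x := by
  rw [clogDecay, logDecay, ← h.ofReal_iterate_log le_rfl, ← Complex.ofReal_log h.1.le,
    ← Complex.ofReal_cpow (h.iterate_log_pos le_rfl).le]
  push_cast
  rfl

theorem norm_iterate_log_sub_le {ρ : ℝ} (h : LogsGeTwo k x) (hρ : ρ ≤ 1)
    (hz : ‖Complex.log z - Real.log x‖ ≤ ρ) (h1 : 1 ≤ j) (hj : j ≤ k) :
    ‖Complex.log^[j] z - (Real.log^[j] x : ℝ)‖ ≤ ρ := by
  induction j, h1 using Nat.le_induction with
  | base => exact hz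
  | succ j h1 ih =>
    have hprev := ih (by omega)
    have h2 := h.2 j h1 (by omega)
    rw [Function.iterate_succ_apply', Function.iterate_succ_apply',
      Complex.ofReal_log (by linarith)]
    refine (norm_log_sub_log_le (one_le_re_of_norm_sub_le h2 (hprev.trans hρ)) ?_).trans hprev
    rw [Complex.ofReal_re]
    linarith

theorem one_le_re_iterate_log (h : LogsGeTwo k x) (hz : ‖Complex.log z - Real.log x‖ ≤ 1)
    (h1 : 1 ≤ j) (hj : j ≤ k) : 1 ≤ (Complex.log^[j] z).re :=
  one_le_re_of_norm_sub_le (h.2 j h1 hj) (norm_iterate_log_sub_le h le_rfl hz h1 hj)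

theorem differentiableAt_iterate_log (h : ∀ i < j, Complex.log^[i] z ∈ Complex.slitPlane) :
    DifferentiableAt ℂ Complex.log^[j] z := by
  induction j with
  | zero => exact differentiableAt_id
  | succ j ih =>
    rw [Function.iterate_succ']
    exact (Complex.differentiableAt_log (h j j.lt_succ_self)).comp z
      (ih fun i hi => h i (hi.trans j.lt_succ_self))

theorem differentiableAt_clogDecay (h : LogsGeTwo k x) (hslit : z ∈ Complex.slitPlane)
    (hz : ‖Complex.log z - Real.log x‖ ≤ 1) : DifferentiableAt ℂ (clogDecay k s B) z := by
  have hmem : ∀ i ≤ k, Complex.log^[i] z ∈ Complex.slitPlane := fun i hi => by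
    rcases Nat.eq_zero_or_pos i with rfl | hi0
    · exact hslit
    · exact Or.inl (one_pos.trans_le (one_le_re_iterate_log h hz hi0 hi))
  exact (((Complex.differentiableAt_log hslit).const_mul _).mul
    ((differentiableAt_iterate_log fun i hi => hmem i hi.le).cpow
      (differentiableAt_const _) (hmem k le_rfl))).neg.cexp

theorem norm_div_ofReal_sub_one_le {a : ℝ} (ha : 1 ≤ a) : ‖z / a - 1‖ ≤ ‖z - a‖ := by
  have ha0 : (a : ℂ) ≠ 0 := by exact_mod_cast (one_pos.trans_le ha).ne'
  rw [div_sub_one ha0, norm_div, Complex.norm_real, Real.norm_of_nonneg (zero_le_one.trans ha)]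
  exact div_le_self (norm_nonneg _) ha

theorem cpow_eq_ofReal_rpow_mul_cpow_div {b : ℝ} (hb : 0 < b) (hz : z ≠ 0) :
    z ^ (s : ℂ) = ((b ^ s : ℝ) : ℂ) * (z / b) ^ (s : ℂ) := by
  have hb0 : (b : ℂ) ≠ 0 := by exact_mod_cast hb.ne'
  have hzb : z / b ≠ 0 := div_ne_zero hz hb0
  have hlog : Complex.log z = Real.log b + Complex.log (z / b) := by
    rw [← Complex.log_ofReal_mul hb hzb, mul_div_cancel₀ z hb0]
  rw [Complex.cpow_def_of_ne_zero hz, Complex.cpow_def_of_ne_zero hzb, hlog, add_mul,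
    Complex.exp_add, Real.rpow_def_of_pos hb]
  push_cast
  rfl

theorem norm_clogDecay_le {ρ : ℝ} (hk : k ≠ 0) (hB : 0 ≤ B) (hρ1 : ρ ≤ 1)
    (hρ : ∀ u v : ℂ, ‖u - 1‖ ≤ ρ → ‖v - 1‖ ≤ ρ → 1 / 2 ≤ (u * v ^ (s : ℂ)).re)
    (h : LogsGeTwo k x) (hz : ‖Complex.log z - Real.log x‖ ≤ ρ) :
    ‖clogDecay k s B z‖ ≤ logDecay k s (B / 2) x := by
  have hk1 : 1 ≤ k := Nat.one_le_iff_ne_zero.2 hk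
  set a := Real.log x
  set b := Real.log^[k] x
  have ha : 2 ≤ a := h.2 1 le_rfl hk1
  have hb : 2 ≤ b := h.2 k hk1 le_rfl
  have hv := norm_iterate_log_sub_le h hρ1 hz hk1 le_rfl
  have hv0 : Complex.log^[k] z ≠ 0 := fun h0 => by
    have := one_le_re_iterate_log h (hz.trans hρ1) hk1 le_rfl
    rw [h0, Complex.zero_re] at this
    linarith
  have hratio := hρ (Complex.log z / a) (Complex.log^[k] z / b)
    ((norm_div_ofReal_sub_one_le (by linarith)).trans hz)
    ((norm_div_ofReal_sub_one_le (by linarith)).trans hv)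
  have hfactor : (B : ℂ) * Complex.log z * Complex.log^[k] z ^ (s : ℂ) =
      ((B * a * b ^ s : ℝ) : ℂ) * (Complex.log z / a * (Complex.log^[k] z / b) ^ (s : ℂ)) := by
    have ha0 : (a : ℂ) ≠ 0 := by exact_mod_cast (by linarith : a ≠ 0)
    rw [cpow_eq_ofReal_rpow_mul_cpow_div (by linarith : 0 < b) hv0]
    push_cast
    field_simp
  rw [clogDecay, logDecay, Complex.norm_exp, Complex.neg_re, hfactor, Complex.re_ofReal_mul,
    Real.exp_le_exp]
  have hnonneg : 0 ≤ B * a * b ^ s := by positivity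
  nlinarith

theorem exists_half_le_re_mul_cpow (s : ℝ) :
    ∃ ρ ∈ Ioc (0 : ℝ) 1, ∀ u v : ℂ, ‖u - 1‖ ≤ ρ → ‖v - 1‖ ≤ ρ →
      1 / 2 ≤ (u * v ^ (s : ℂ)).re := by
  have hc : ContinuousAt (fun p : ℂ × ℂ => (p.1 * p.2 ^ (s : ℂ)).re) (1, 1) := by
    refine Complex.continuous_re.continuousAt.comp (continuousAt_fst.mul ?_)
    exact continuousAt_snd.cpow continuousAt_const (by simp)
  obtain ⟨r, hr, hball⟩ := Metric.nhds_basis_closedBall.eventually_iff.1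
    (hc.eventually (lt_mem_nhds (by norm_num : (1 / 2 : ℝ) < _)))
  refine ⟨min r 1, ⟨by positivity, min_le_right _ _⟩, fun u v hu hv => ?_⟩
  refine (hball (x := (u, v)) ?_).le
  rw [Metric.mem_closedBall, Prod.dist_eq, dist_eq_norm, dist_eq_norm]
  exact max_le (hu.trans (min_le_left _ _)) (hv.trans (min_le_left _ _))

theorem eventually_clogDecay (hk : k ≠ 0) (hB : 0 ≤ B) (s : ℝ) :
    ∀ᶠ ζ : ℂ in 𝓝 1, ∀ x, LogsGeTwo k x → DifferentiableAt ℂ (clogDecay k s B) (x * ζ) ∧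
      ‖clogDecay k s B (x * ζ)‖ ≤ logDecay k s (B / 2) x := by
  obtain ⟨ρ, ⟨hρ0, hρ1⟩, hρ⟩ := exists_half_le_re_mul_cpow s
  have hlog : ∀ᶠ ζ : ℂ in 𝓝 1, ‖Complex.log ζ‖ < ρ :=
    (continuousAt_id.clog (by simp)).norm.eventually (gt_mem_nhds (by simpa using hρ0))
  have hre : ∀ᶠ ζ : ℂ in 𝓝 1, 0 < ζ.re :=
    Complex.continuous_re.continuousAt.eventually (lt_mem_nhds (by simp))
  filter_upwards [hlog, hre] with ζ hζlog hζre x h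
  have hζ0 : ζ ≠ 0 := fun h0 => hζre.ne' (by simp [h0])
  have hz : ‖Complex.log (x * ζ) - Real.log x‖ ≤ ρ := by
    rw [Complex.log_ofReal_mul h.1 hζ0, add_sub_cancel_left]
    exact hζlog.le
  have hslit : (x : ℂ) * ζ ∈ Complex.slitPlane :=
    Or.inl (by rw [Complex.re_ofReal_mul]; exact mul_pos h.1 hζre)
  exact ⟨differentiableAt_clogDecay h hslit (hz.trans hρ1),
    norm_clogDecay_le hk hB hρ1 hρ h hz⟩

theorem LogsGeTwo.one_div_mul {δ t : ℝ} (h : LogsGeTwo k (1 / δ)) (ht : t ∈ Ioc (0 : ℝ) 1) :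
    LogsGeTwo k (1 / (δ * t)) := by
  have hδ : 0 < δ := one_div_pos.1 h.1
  exact h.mono (one_div_le_one_div_of_le (mul_pos hδ ht.1) (mul_le_of_le_one_right hδ.le ht.2))

theorem exists_clogDecay_one_div_mul (hk : k ≠ 0) (hB : 0 ≤ B) (s : ℝ) {δ : ℝ}
    (hδ : LogsGeTwo k (1 / δ)) :
    ∃ η > 0, ∀ t ∈ Ioc (0 : ℝ) 1, ∀ z ∈ Metric.closedBall (t : ℂ) (η * t),
      DifferentiableAt ℂ (fun z : ℂ => clogDecay k s B (1 / (δ * z))) z ∧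
        ‖clogDecay k s B (1 / (δ * z))‖ ≤ logDecay k s (B / 2) (1 / (δ * t)) := by
  have hinv : Tendsto (fun ζ : ℂ => ζ⁻¹) (𝓝 1) (𝓝 1) := by
    simpa using tendsto_inv₀ (one_ne_zero (α := ℂ))
  obtain ⟨η, hη, hball⟩ := Metric.nhds_basis_closedBall.eventually_iff.1
    ((hinv.eventually (eventually_clogDecay hk hB s)).and (eventually_ne_nhds one_ne_zero))
  refine ⟨η, hη, fun t ht z hz => ?_⟩
  have ht0 : (t : ℂ) ≠ 0 := by exact_mod_cast ht.1.ne'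
  have hδ0 : (δ : ℂ) ≠ 0 := by exact_mod_cast (one_div_pos.1 hδ.1).ne'
  have hζ : z / t ∈ Metric.closedBall (1 : ℂ) η := by
    rw [mem_closedBall_iff_norm] at hz ⊢
    rwa [div_sub_one ht0, norm_div, Complex.norm_real, Real.norm_of_nonneg ht.1.le,
      div_le_iff₀ ht.1]
  obtain ⟨hest, hζ0⟩ := hball hζ
  have hfactor : 1 / ((δ : ℂ) * z) = (1 / (δ * t) : ℝ) * (z / t)⁻¹ := by
    push_cast
    field_simp
  have hz0 : z ≠ 0 := fun h => hζ0 (by rw [h, zero_div])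
  obtain ⟨hdiff, hnorm⟩ := hest _ (hδ.one_div_mul ht)
  rw [← hfactor] at hdiff hnorm
  have hinner : DifferentiableAt ℂ (fun z : ℂ => 1 / ((δ : ℂ) * z)) z :=
    (differentiableAt_const _).div (by fun_prop) (mul_ne_zero hδ0 hz0)
  exact ⟨DifferentiableAt.comp (g := clogDecay k s B) z hdiff hinner, hnorm⟩

end ComplexExtension

section Gluing

/-- `F` is holomorphic, with a bound `A q t^q` of every order `q`, on the discs `|z - t| ≤ η t`
with `0 < t ≤ 1`. These conditions make `Re F` on `t > 0` glue smoothly to `0` on `t ≤ 0`. -/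
structure IsFlatOnDiscs (F : ℂ → ℂ) (η : ℝ) (A : ℕ → ℝ) : Prop where
  radius_pos : 0 < η
  differentiableAt : ∀ t ∈ Ioc (0 : ℝ) 1, ∀ z ∈ Metric.closedBall (t : ℂ) (η * t),
    DifferentiableAt ℂ F z
  norm_le : ∀ t ∈ Ioc (0 : ℝ) 1, ∀ z ∈ Metric.closedBall (t : ℂ) (η * t),
    ∀ q, ‖F z‖ ≤ A q * t ^ q

/-- The `n`-th derivative of the function equal to `0` for `t ≤ 0` and to `Re F` for `t > 0`. -/
def gluedDeriv (F : ℂ → ℂ) (n : ℕ) (t : ℝ) : ℝ :=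
  if t ≤ 0 then 0 else (iteratedDeriv n F t).re

variable {F : ℂ → ℂ} {η t : ℝ} {A M : ℕ → ℝ} {ψ : ℝ → ℝ}

theorem gluedDeriv_of_nonpos (F : ℂ → ℂ) (n : ℕ) (ht : t ≤ 0) : gluedDeriv F n t = 0 := if_pos ht

theorem gluedDeriv_of_pos (F : ℂ → ℂ) (n : ℕ) (ht : 0 < t) :
    gluedDeriv F n t = (iteratedDeriv n F t).re := if_neg ht.not_ge

theorem differentiableOn_iteratedDeriv {U : Set ℂ} (hU : IsOpen U) (hF : DifferentiableOn ℂ F U)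
    (n : ℕ) : DifferentiableOn ℂ (iteratedDeriv n F) U := by
  induction n with
  | zero => rwa [iteratedDeriv_zero]
  | succ n ih =>
    rw [iteratedDeriv_succ]
    exact ih.deriv hU

theorem iteratedDerivWithin_eq_of_hasDerivWithinAt {S : Set ℝ} (hS : UniqueDiffOn ℝ S)
    {f : ℕ → ℝ → ℝ} (h0 : ∀ t ∈ S, f 0 t = ψ t)
    (hf : ∀ n, ∀ t ∈ S, HasDerivWithinAt (f n) (f (n + 1) t) S t) (n : ℕ) :
    ∀ t ∈ S, iteratedDerivWithin n ψ S t = f n t := by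
  induction n with
  | zero =>
    intro t ht
    rw [iteratedDerivWithin_zero, h0 t ht]
  | succ n ih =>
    intro t ht
    rw [iteratedDerivWithin_succ, derivWithin_congr ih (ih t ht)]
    exact (hf n t ht).derivWithin (hS t ht)

theorem exists_forall_le_pow_mul {u : ℕ → ℝ} (hM : ∀ n, 0 < M n) {b : ℝ} (hb : 0 ≤ b)
    (h : ∀ᶠ n in atTop, u n ≤ b ^ n * M n) : ∃ K, 0 < K ∧ ∀ n, u n ≤ K ^ (n + 1) * M n := by
  obtain ⟨N, hN⟩ := eventually_atTop.1 h
  set S := ∑ n ∈ Finset.range N, |u n| / M n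
  have hterm : ∀ n, 0 ≤ |u n| / M n := fun n => div_nonneg (abs_nonneg _) (hM n).le
  have hS : 0 ≤ S := Finset.sum_nonneg fun n _ => hterm n
  have hK1 : 1 ≤ 1 + b + S := by linarith
  refine ⟨1 + b + S, by positivity, fun n => ?_⟩
  have hM0 := (hM n).le
  rcases lt_or_ge n N with hn | hn
  · rw [← div_le_iff₀ (hM n)]
    calc u n / M n ≤ |u n| / M n := by gcongr; exact le_abs_self _
      _ ≤ S := Finset.single_le_sum (f := fun n => |u n| / M n) (fun n _ => hterm n)
          (Finset.mem_range.2 hn)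
      _ ≤ 1 + b + S := by linarith
      _ ≤ (1 + b + S) ^ (n + 1) := le_self_pow₀ hK1 n.succ_ne_zero
  · calc u n ≤ b ^ n * M n := hN n hn
      _ ≤ (1 + b + S) ^ n * M n := by gcongr; linarith
      _ ≤ (1 + b + S) ^ (n + 1) * M n := by gcongr; exact n.le_succ

namespace IsFlatOnDiscs

theorem bound_nonneg (h : IsFlatOnDiscs F η A) (q : ℕ) : 0 ≤ A q := by
  have h1 := h.norm_le 1 ⟨one_pos, le_rfl⟩ 1
    (by simpa using h.radius_pos.le) q
  rw [one_pow, mul_one] at h1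
  exact (norm_nonneg _).trans h1

theorem abs_gluedDeriv_le (h : IsFlatOnDiscs F η A) (n q : ℕ) (ht : t ∈ I) :
    |gluedDeriv F n t| ≤ n.factorial * η⁻¹ ^ n * A (n + q) * |t| ^ q := by
  have hη := h.radius_pos
  rcases le_or_gt t 0 with ht0 | ht0
  · have hA := h.bound_nonneg (n + q)
    rw [gluedDeriv_of_nonpos F n ht0, abs_zero]
    positivity
  have hdiff : DiffContOnCl ℂ F (Metric.ball (t : ℂ) (η * t)) :=
    DifferentiableOn.diffContOnCl_ball (U := Metric.closedBall (t : ℂ) (η * t))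
      (fun z hz => (h.differentiableAt t ⟨ht0, ht.2⟩ z hz).differentiableWithinAt) le_rfl
  have hcauchy := Complex.norm_iteratedDeriv_le_of_forall_mem_sphere_norm_le n (mul_pos hη ht0)
    hdiff fun z hz => h.norm_le t ⟨ht0, ht.2⟩ z (Metric.sphere_subset_closedBall hz) (n + q)
  rw [gluedDeriv_of_pos F n ht0, abs_of_pos ht0]
  refine ((Complex.abs_re_le_norm _).trans hcauchy).trans_eq ?_
  rw [mul_pow, pow_add, inv_pow]
  field_simp

theorem hasDerivWithinAt_gluedDeriv_zero (h : IsFlatOnDiscs F η A) (n : ℕ) :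
    HasDerivWithinAt (gluedDeriv F n) 0 I 0 := by
  rw [hasDerivWithinAt_iff_isLittleO]
  simp only [gluedDeriv_of_nonpos F n le_rfl, sub_zero, smul_zero]
  have hO : gluedDeriv F n =O[𝓝[I] 0] fun t : ℝ => t ^ 2 := by
    refine IsBigO.of_bound (n.factorial * η⁻¹ ^ n * A (n + 2)) ?_
    filter_upwards [self_mem_nhdsWithin] with t ht
    rw [Real.norm_eq_abs, norm_pow, Real.norm_eq_abs]
    exact h.abs_gluedDeriv_le n 2 ht
  exact hO.trans_isLittleO ((isLittleO_pow_id one_lt_two).mono nhdsWithin_le_nhds)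

theorem hasDerivAt_gluedDeriv_of_pos (h : IsFlatOnDiscs F η A) (n : ℕ) (ht : t ∈ Ioc (0 : ℝ) 1) :
    HasDerivAt (gluedDeriv F n) (gluedDeriv F (n + 1) t) t := by
  have hdiff : DifferentiableOn ℂ (iteratedDeriv n F) (Metric.ball (t : ℂ) (η * t)) :=
    differentiableOn_iteratedDeriv Metric.isOpen_ball (fun z hz => (h.differentiableAt t ht z
      (Metric.ball_subset_closedBall hz)).differentiableWithinAt) n
  have hderiv := (hdiff.differentiableAt
    (Metric.ball_mem_nhds _ (mul_pos h.radius_pos ht.1))).hasDerivAt.real_of_complex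
  rw [← iteratedDeriv_succ] at hderiv
  rw [gluedDeriv_of_pos F (n + 1) ht.1]
  refine hderiv.congr_of_eventuallyEq ?_
  filter_upwards [Ioi_mem_nhds ht.1] with x hx
  exact gluedDeriv_of_pos F n hx

theorem hasDerivWithinAt_gluedDeriv (h : IsFlatOnDiscs F η A) (n : ℕ) (ht : t ∈ I) :
    HasDerivWithinAt (gluedDeriv F n) (gluedDeriv F (n + 1) t) I t := by
  rcases lt_trichotomy t 0 with ht0 | rfl | ht0
  · rw [gluedDeriv_of_nonpos F (n + 1) ht0.le]
    refine HasDerivAt.hasDerivWithinAt ((hasDerivAt_const t (0 : ℝ)).congr_of_eventuallyEq ?_)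
    filter_upwards [Iio_mem_nhds ht0] with x hx
    exact gluedDeriv_of_nonpos F n (le_of_lt hx)
  · rw [gluedDeriv_of_nonpos F (n + 1) le_rfl]
    exact h.hasDerivWithinAt_gluedDeriv_zero n
  · exact (h.hasDerivAt_gluedDeriv_of_pos n ⟨ht0, ht.2⟩).hasDerivWithinAt

theorem iteratedDerivWithin_eq (h : IsFlatOnDiscs F η A) (hψ : ∀ t ∈ I, gluedDeriv F 0 t = ψ t)
    (n : ℕ) : ∀ t ∈ I, iteratedDerivWithin n ψ I t = gluedDeriv F n t :=
  iteratedDerivWithin_eq_of_hasDerivWithinAt uniqueDiffOn_I hψ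
    (fun n _ => h.hasDerivWithinAt_gluedDeriv n) n

theorem flatAtZero (h : IsFlatOnDiscs F η A) (hψ : ∀ t ∈ I, gluedDeriv F 0 t = ψ t) :
    FlatAtZero ψ := fun n => by
  rw [h.iteratedDerivWithin_eq hψ n 0 (by simp [I]), gluedDeriv_of_nonpos F n le_rfl]

theorem denjoyCarleman (h : IsFlatOnDiscs F η A) (hψ : ∀ t ∈ I, gluedDeriv F 0 t = ψ t)
    (hM : ∀ n, 0 < M n) (hA : ∀ᶠ n in atTop, n.factorial * A n ≤ M n) :
    DenjoyCarleman M ψ := by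
  have hη := h.radius_pos
  have heq := h.iteratedDerivWithin_eq hψ
  obtain ⟨K, hK, hbound⟩ := exists_forall_le_pow_mul
    (u := fun n => n.factorial * η⁻¹ ^ n * A n) hM (inv_nonneg.2 hη.le) (by
      filter_upwards [hA] with n hn
      calc n.factorial * η⁻¹ ^ n * A n = η⁻¹ ^ n * (n.factorial * A n) := by ring
        _ ≤ η⁻¹ ^ n * M n := by gcongr)
  refine ⟨contDiffOn_of_differentiableOn_deriv fun n _ t ht => ?_, K, hK, fun n t ht => ?_⟩
  · exact ((h.hasDerivWithinAt_gluedDeriv n ht).congr (heq n) (heq n t ht)).differentiableWithinAt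
  · rw [heq n t ht]
    refine le_trans ?_ (hbound n)
    simpa using h.abs_gluedDeriv_le n 0 ht

end IsFlatOnDiscs

end Gluing

section Weight

/-- The majorant `exp (q exp^{(k-1)} ((q/B)^α))` of `x^q` times `logDecay k (1 / α) B x`. -/
def decayBound (k : ℕ) (α B : ℝ) (q : ℕ) : ℝ :=
  Real.exp (q * Real.exp^[k - 1] ((q / B) ^ α))

variable {k : ℕ} {c α B δ : ℝ}

theorem iterate_exp_nonneg {a : ℝ} (ha : 0 ≤ a) (j : ℕ) : 0 ≤ Real.exp^[j] a := by
  cases j with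
  | zero => exact ha
  | succ j =>
    rw [Function.iterate_succ_apply']
    exact Real.exp_nonneg _

theorem pow_mul_logDecay_le (hk : k ≠ 0) (hα : 0 < α) (hB : 0 < B) {x : ℝ} (h : LogsGeTwo k x)
    (q : ℕ) : x ^ q * logDecay k (1 / α) B x ≤ decayBound k α B q := by
  set l := Real.log^[k] x
  have hl : 0 < l := h.iterate_log_pos le_rfl
  have hlog : Real.exp^[k - 1] l = Real.log x := by
    have hlog := h.iterate_exp_iterate_log (j := k - 1) (i := 1) (by omega)
    rwa [Nat.sub_add_cancel (Nat.one_le_iff_ne_zero.2 hk)] at hlog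
  have hlog0 : 0 < Real.log x := h.iterate_log_pos (j := 1) (by omega)
  have hE0 := iterate_exp_nonneg (by positivity : 0 ≤ ((q : ℝ) / B) ^ α) (k - 1)
  calc x ^ q * logDecay k (1 / α) B x = Real.exp ((q - B * l ^ (1 / α)) * Real.log x) := by
        rw [← Real.exp_log (pow_pos h.1 q), Real.log_pow, logDecay, ← Real.exp_add]
        congr 1
        ring
    _ ≤ decayBound k α B q := by
        rw [decayBound, Real.exp_le_exp]
        rcases le_or_gt ((q : ℝ) / B) (l ^ (1 / α)) with hq | hq
        · rw [div_le_iff₀' hB] at hq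
          exact (mul_nonpos_of_nonpos_of_nonneg (sub_nonpos.2 hq) hlog0.le).trans (by positivity)
        · have hle : l ≤ (q / B) ^ α := by
            calc l = (l ^ (1 / α)) ^ α := by
                  rw [← Real.rpow_mul hl.le, one_div_mul_cancel hα.ne', Real.rpow_one]
              _ ≤ (q / B) ^ α := by gcongr
          have hlogle := hlog ▸ monotone_iterate_exp (k - 1) hle
          gcongr
          exact sub_le_self _ (by positivity)

theorem sub_le_iterate_exp_sub {a b : ℝ} (ha : 0 ≤ a) (hab : a ≤ b) (j : ℕ) :
    b - a ≤ Real.exp^[j] b - Real.exp^[j] a := by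
  induction j with
  | zero => exact le_rfl
  | succ j ih =>
    rw [Function.iterate_succ_apply', Function.iterate_succ_apply']
    have hu := iterate_exp_nonneg ha j
    set u := Real.exp^[j] a
    set v := Real.exp^[j] b
    have hmul : Real.exp v = Real.exp u * Real.exp (v - u) := by
      rw [← Real.exp_add, add_sub_cancel]
    nlinarith [Real.add_one_le_exp (v - u), Real.one_le_exp hu]

theorem exp_sub_mul_iterate_exp_le {a b : ℝ} (ha : 0 ≤ a) (hab : a ≤ b) (j : ℕ) :
    Real.exp (b - a) * Real.exp^[j + 1] a ≤ Real.exp^[j + 1] b := by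
  rw [Function.iterate_succ_apply', Function.iterate_succ_apply', ← Real.exp_add, Real.exp_le_exp]
  linarith [sub_le_iterate_exp_sub ha hab j]

theorem eventually_two_mul_sq_le_exp_rpow {ε : ℝ} (hε : 0 < ε) (hα : 0 < α) :
    ∀ᶠ x : ℝ in atTop, 2 * x ^ 2 ≤ Real.exp (ε * x ^ α) := by
  have hbound := ((isLittleO_rpow_exp_pos_mul_atTop (2 / α) hε).bound
    (by norm_num : (0 : ℝ) < 1 / 2))
  filter_upwards [(tendsto_rpow_atTop hα).eventually hbound, eventually_ge_atTop 0] with x hx hx0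
  rw [Real.norm_of_nonneg (by positivity), Real.norm_of_nonneg (Real.exp_nonneg _),
    ← Real.rpow_mul hx0, mul_div_cancel₀ 2 hα.ne', Real.rpow_two] at hx
  linarith

theorem factorial_le_exp_sq (n : ℕ) : (n.factorial : ℝ) ≤ Real.exp ((n : ℝ) ^ 2) := by
  calc (n.factorial : ℝ) ≤ (n : ℝ) ^ n := by exact_mod_cast n.factorial_le_pow
    _ ≤ Real.exp n ^ n := by
        gcongr
        linarith [Real.add_one_le_exp (n : ℝ)]
    _ = Real.exp ((n : ℝ) ^ 2) := by rw [← Real.exp_nat_mul, sq]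

theorem eventually_factorial_mul_decayBound_le (hk : 2 ≤ k) (hα : 0 < α) (hB : 0 < B)
    (hBc : (1 / B) ^ α < c) :
    ∀ᶠ n : ℕ in atTop, n.factorial * decayBound k α B n ≤ weight k c α n := by
  obtain ⟨i, rfl⟩ : ∃ i, k = i + 2 := Nat.exists_eq_add_of_le' hk
  filter_upwards [tendsto_natCast_atTop_atTop.eventually
    (eventually_two_mul_sq_le_exp_rpow (sub_pos.2 hBc) hα), eventually_ge_atTop 1] with n hexp hn
  have hn1 : (1 : ℝ) ≤ n := by exact_mod_cast hn
  set a := (1 / B) ^ α * (n : ℝ) ^ α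
  have ha : 0 ≤ a := by positivity
  have hdecay : decayBound (i + 2) α B n = Real.exp (n * Real.exp^[i + 1] a) := by
    rw [decayBound, div_eq_inv_mul, ← one_div, Real.mul_rpow (by positivity) (by positivity)]
    rfl
  have hE : 1 ≤ Real.exp^[i + 1] a := by
    rw [Function.iterate_succ_apply']
    exact Real.one_le_exp (iterate_exp_nonneg ha i)
  have hac : a ≤ c * (n : ℝ) ^ α := mul_le_mul_of_nonneg_right hBc.le (by positivity)
  calc n.factorial * decayBound (i + 2) α B n
      ≤ Real.exp ((n : ℝ) ^ 2) * Real.exp (n * Real.exp^[i + 1] a) := by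
        rw [hdecay]
        gcongr
        exact factorial_le_exp_sq n
    _ = Real.exp ((n : ℝ) ^ 2 + n * Real.exp^[i + 1] a) := by rw [Real.exp_add]
    _ ≤ Real.exp (2 * (n : ℝ) ^ 2 * Real.exp^[i + 1] a) := by
        rw [Real.exp_le_exp]
        have hsq : (n : ℝ) ≤ (n : ℝ) ^ 2 := le_self_pow₀ hn1 two_ne_zero
        nlinarith
    _ ≤ Real.exp (Real.exp^[i + 1] (c * (n : ℝ) ^ α)) := by
        rw [Real.exp_le_exp]
        refine le_trans ?_ (exp_sub_mul_iterate_exp_le ha hac i)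
        rw [← sub_mul]
        gcongr
    _ = weight (i + 2) c α n := by rw [weight, Function.iterate_succ_apply' _ (i + 1)]

theorem weight_pos (hk : k ≠ 0) (c α : ℝ) (n : ℕ) : 0 < weight k c α n := by
  obtain ⟨i, rfl⟩ := Nat.exists_eq_succ_of_ne_zero hk
  rw [weight, Function.iterate_succ_apply']
  exact Real.exp_pos _

theorem exists_isFlatOnDiscs_clogDecay (hk : k ≠ 0) (hα : 0 < α) (hB : 0 < B)
    (hδ : LogsGeTwo k (1 / δ)) :
    ∃ η, IsFlatOnDiscs (fun z => clogDecay k (1 / α) B (1 / (δ * z))) η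
      (decayBound k α (B / 2)) := by
  obtain ⟨η, hη, hest⟩ := exists_clogDecay_one_div_mul hk hB.le (1 / α) hδ
  refine ⟨η, hη, fun t ht z hz => (hest t ht z hz).1, fun t ht z hz q => ?_⟩
  have hδ0 : 0 < δ := one_div_pos.1 hδ.1
  have hδ1 : δ ≤ 1 := by
    have h1 : (1 : ℝ) ≤ 1 / δ :=
      one_le_two.trans ((hδ.2 1 le_rfl (by omega)).trans (Real.log_le_self hδ.1.le))
    rwa [one_le_div hδ0] at h1
  have htx : 1 / t ≤ 1 / (δ * t) :=
    one_div_le_one_div_of_le (mul_pos hδ0 ht.1) (mul_le_of_le_one_left ht.1.le hδ1)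
  have ht0 := ht.1
  rw [← div_le_iff₀ (by positivity), div_eq_mul_one_div, mul_comm, ← one_div_pow]
  calc (1 / t) ^ q * ‖clogDecay k (1 / α) B (1 / (δ * z))‖
      ≤ (1 / (δ * t)) ^ q * logDecay k (1 / α) (B / 2) (1 / (δ * t)) := by
        gcongr
        exact (hest t ht z hz).2
    _ ≤ decayBound k α (B / 2) q := pow_mul_logDecay_le hk hα (by positivity) (hδ.one_div_mul ht) q

theorem gluedDeriv_clogDecay (hδ : LogsGeTwo k (1 / δ)) {t : ℝ} (ht : t ∈ I) :
    gluedDeriv (fun z => clogDecay k (1 / α) B (1 / (δ * z))) 0 t = flatPhase k α B δ t := by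
  rcases le_or_gt t 0 with ht0 | ht0
  · rw [gluedDeriv_of_nonpos _ _ ht0, flatPhase, if_pos ht0]
  · have hcast : (1 / (δ * t) : ℂ) = (1 / (δ * t) : ℝ) := by push_cast; rfl
    rw [gluedDeriv_of_pos _ _ ht0, iteratedDeriv_zero, flatPhase_of_pos k α B δ ht0]
    rw [hcast, clogDecay_ofReal (hδ.one_div_mul ⟨ht0, ht.2⟩), Complex.ofReal_re]

theorem flatAtZero_flatPhase (hk : k ≠ 0) (hα : 0 < α) (hB : 0 < B) (hδ : LogsGeTwo k (1 / δ)) :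
    FlatAtZero (flatPhase k α B δ) := by
  obtain ⟨η, h⟩ := exists_isFlatOnDiscs_clogDecay hk hα hB hδ
  exact h.flatAtZero fun t => gluedDeriv_clogDecay hδ

theorem denjoyCarleman_flatPhase (hk : 2 ≤ k) (hα : 0 < α) (hB : 0 < B) (hBc : (2 / B) ^ α < c)
    (hδ : LogsGeTwo k (1 / δ)) : DenjoyCarleman (weight k c α) (flatPhase k α B δ) := by
  obtain ⟨η, h⟩ := exists_isFlatOnDiscs_clogDecay (by omega) hα hB hδ
  refine h.denjoyCarleman (fun t => gluedDeriv_clogDecay hδ) (weight_pos (by omega) c α) ?_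
  exact eventually_factorial_mul_decayBound_le hk hα (by positivity) (by rwa [one_div_div])

end Weight

section LowerBound

theorem half_le_integral_one_sub_cos_mul {Λ y : ℝ} (hΛ : 0 < Λ) (hy : 4 ≤ Λ * y) :
    Λ / 2 ≤ ∫ lam in Λ..2 * Λ, (1 - Real.cos (lam * y)) := by
  have hy0 : 0 < y := pos_of_mul_pos_right (by linarith) hΛ.le
  have hsin : y⁻¹ * (Real.sin (2 * Λ * y) - Real.sin (Λ * y)) ≤ Λ / 2 := by
    rw [inv_mul_le_iff₀ hy0]
    linarith [Real.sin_le_one (2 * Λ * y), Real.neg_one_le_sin (Λ * y)]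
  rw [intervalIntegral.integral_sub (by simp) (Continuous.intervalIntegrable (by fun_prop) _ _),
    intervalIntegral.integral_comp_mul_right (fun x => Real.cos x) hy0.ne', integral_cos,
    intervalIntegral.integral_const, smul_eq_mul, smul_eq_mul, mul_one]
  linarith

theorem integrable_one_sub_cos_div {ψ : ℝ → ℝ} {t₀ : ℝ} (ht0 : 0 < t₀)
    (hψ : ContinuousOn ψ (Icc t₀ 1)) (a b : ℝ) :
    Integrable (fun z : ℝ × ℝ => (1 - Real.cos (z.1 * ψ z.2)) / z.2)
      ((volume.restrict (Ioc a b)).prod (volume.restrict (Ioc t₀ 1))) := by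
  have hcont : ContinuousOn (fun z : ℝ × ℝ => (1 - Real.cos (z.1 * ψ z.2)) / z.2)
      (Icc a b ×ˢ Icc t₀ 1) := by
    have hψ2 : ContinuousOn (fun z : ℝ × ℝ => ψ z.2) (Icc a b ×ˢ Icc t₀ 1) :=
      hψ.comp continuousOn_snd fun z hz => hz.2
    exact ContinuousOn.div (continuousOn_const.sub
      (Real.continuous_cos.comp_continuousOn (continuousOn_fst.mul hψ2))) continuousOn_snd
      fun z hz => (ht0.trans_le hz.2.1).ne'
  rw [Measure.prod_restrict]
  exact (hcont.integrableOn_compact (isCompact_Icc.prod isCompact_Icc)).mono_set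
    (prod_mono Ioc_subset_Icc_self Ioc_subset_Icc_self)

/-- Averaging over `lam ∈ [Λ, 2Λ]` removes the oscillation. -/
theorem exists_half_log_le_integral_one_sub_cos {ψ : ℝ → ℝ} {t₀ Λ : ℝ} (ht0 : 0 < t₀)
    (ht1 : t₀ ≤ 1) (hψ : ContinuousOn ψ (Icc t₀ 1)) (hΛ : 0 < Λ)
    (hΛψ : ∀ t ∈ Icc t₀ 1, 4 ≤ Λ * ψ t) :
    ∃ lam ∈ Icc Λ (2 * Λ),
      Real.log t₀⁻¹ / 2 ≤ ∫ t in Ioc t₀ 1, (1 - Real.cos (lam * ψ t)) / t := by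
  have hΛ2 : Λ ≤ 2 * Λ := by linarith
  have hint := integrable_one_sub_cos_div ht0 hψ Λ (2 * Λ)
  have hvol : volume (Ioc Λ (2 * Λ)) ≠ 0 := by
    rw [Real.volume_Ioc, Ne, ENNReal.ofReal_eq_zero]
    linarith
  obtain ⟨lam, hlam, hle⟩ := exists_setAverage_le hvol measure_Ioc_lt_top.ne hint.integral_prod_left
  refine ⟨lam, Ioc_subset_Icc_self hlam, le_trans ?_ hle⟩
  have hlog : Real.log t₀⁻¹ = ∫ t in Ioc t₀ 1, t⁻¹ := by
    rw [← intervalIntegral.integral_of_le ht1, integral_inv_of_pos ht0 one_pos, one_div]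
  rw [setAverage_eq, Real.volume_real_Ioc_of_le hΛ2, integral_integral_swap hint, smul_eq_mul,
    le_inv_mul_iff₀ (by linarith), hlog]
  calc (2 * Λ - Λ) * ((∫ t in Ioc t₀ 1, t⁻¹) / 2) = ∫ t in Ioc t₀ 1, Λ / 2 * t⁻¹ := by
        rw [integral_const_mul]
        ring
    _ ≤ ∫ t in Ioc t₀ 1, ∫ lam in Ioc Λ (2 * Λ), (1 - Real.cos (lam * ψ t)) / t := by
        refine setIntegral_mono_on ?_ hint.integral_prod_right measurableSet_Ioc fun t ht => ?_
        · have hinv : ContinuousOn (fun t : ℝ => t⁻¹) (Icc t₀ 1) :=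
            continuousOn_id.inv₀ fun t ht => (ht0.trans_le ht.1).ne'
          exact (hinv.integrableOn_Icc.mono_set Ioc_subset_Icc_self).const_mul _
        · have htpos : 0 < t := ht0.trans ht.1
          rw [integral_div, ← intervalIntegral.integral_of_le hΛ2, ← div_eq_mul_inv]
          gcongr
          exact half_le_integral_one_sub_cos_mul hΛ (hΛψ t (Ioc_subset_Icc_self ht))

variable {M : ℕ → ℝ} {ψ : ℝ → ℝ} {t : ℝ}

theorem DenjoyCarleman.integral_one_sub_cos_le_norm_m (hψ : DenjoyCarleman M ψ)
    (hneg : ∀ u < 0, ψ u = 0) (lam : ℝ) (ht : 0 ≤ t) :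
    ∫ u in Ioc t 1, (1 - Real.cos (lam * ψ u)) / u ≤ ‖m ψ lam‖ := by
  have hint := hψ.integrableOn_oddKernel lam
  have hre : ∀ u ∈ Ioc (0 : ℝ) 1, (1 - Real.cos (lam * ψ u)) / u
      = -(oddKernel (fun u => lam * ψ u) u).re := fun u hu => by
    simp only [oddKernel, hneg (-u) (neg_lt_zero.2 hu.1), mul_zero, Complex.ofReal_zero,
      Complex.exp_zero, Complex.div_ofReal_re, Complex.sub_re, Complex.one_re]
    rw [mul_comm Complex.I, Complex.exp_ofReal_mul_I_re]
    ring
  have hintre : IntegrableOn (fun u => (1 - Real.cos (lam * ψ u)) / u) (Ioc 0 1) :=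
    (integrableOn_congr_fun hre measurableSet_Ioc).2 hint.re.neg
  calc ∫ u in Ioc t 1, (1 - Real.cos (lam * ψ u)) / u
      ≤ ∫ u in Ioc 0 1, (1 - Real.cos (lam * ψ u)) / u := by
        refine setIntegral_mono_set hintre ?_ (Ioc_subset_Ioc_left ht).eventuallyLE
        filter_upwards [ae_restrict_mem measurableSet_Ioc] with u hu
        exact div_nonneg (sub_nonneg.2 (Real.cos_le_one _)) hu.1.le
    _ = ∫ u in Ioc 0 1, -(oddKernel (fun u => lam * ψ u) u).re :=
        setIntegral_congr_fun measurableSet_Ioc hre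
    _ = -(m ψ lam).re := by
        rw [integral_neg, hψ.m_eq]
        exact congrArg Neg.neg (integral_re hint)
    _ ≤ ‖m ψ lam‖ := (neg_le_abs _).trans (Complex.abs_re_le_norm _)

theorem DenjoyCarleman.exists_half_log_le_norm_m (hψ : DenjoyCarleman M ψ)
    (hneg : ∀ u < 0, ψ u = 0) (hmono : MonotoneOn ψ (Ioc 0 1)) (ht : t ∈ Ioc (0 : ℝ) 1)
    (hpos : 0 < ψ t) :
    ∃ lam ∈ Icc (4 / ψ t) (2 * (4 / ψ t)), Real.log t⁻¹ / 2 ≤ ‖m ψ lam‖ := by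
  have hsub : Icc t 1 ⊆ I := Icc_subset_Icc (by linarith [ht.1]) le_rfl
  obtain ⟨lam, hlam, hle⟩ := exists_half_log_le_integral_one_sub_cos ht.1 ht.2
    (hψ.1.continuousOn.mono hsub) (Λ := 4 / ψ t) (by positivity) fun u hu => by
      rw [div_mul_eq_mul_div, le_div_iff₀ hpos]
      gcongr
      exact hmono ht ⟨ht.1.trans_le hu.1, hu.2⟩ hu.1
  exact ⟨lam, hlam, hle.trans (hψ.integral_one_sub_cos_le_norm_m hneg lam ht.1.le)⟩

end LowerBound

section Sharpness

variable {k : ℕ} {c α s B δ x t lam : ℝ}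

theorem logDecay_antitone (hk : k ≠ 0) (hs : 0 ≤ s) (hB : 0 ≤ B) (h : LogsGeTwo k x) {y : ℝ}
    (hxy : x ≤ y) : logDecay k s B y ≤ logDecay k s B x := by
  have hk1 : 1 ≤ k := Nat.one_le_iff_ne_zero.2 hk
  have hlog0 : 0 < Real.log x := h.iterate_log_pos (j := 1) hk1
  have hlog : Real.log x ≤ Real.log y := h.iterate_log_le_iterate_log (j := 1) hxy hk1
  have hiter0 := h.iterate_log_pos le_rfl
  have hiter := h.iterate_log_le_iterate_log hxy le_rfl
  have hlogy0 : 0 < Real.log y := hlog0.trans_le hlog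
  rw [logDecay, logDecay, Real.exp_le_exp, neg_le_neg_iff]
  gcongr

theorem monotoneOn_flatPhase (hk : k ≠ 0) (hα : 0 < α) (hB : 0 < B) (hδ : LogsGeTwo k (1 / δ)) :
    MonotoneOn (flatPhase k α B δ) (Ioc 0 1) := fun t ht u hu htu => by
  have hδ0 : 0 < δ := one_div_pos.1 hδ.1
  have ht0 := ht.1
  rw [flatPhase_of_pos k α B δ ht.1, flatPhase_of_pos k α B δ hu.1]
  exact logDecay_antitone hk (by positivity) hB.le (hδ.one_div_mul hu)
    (one_div_le_one_div_of_le (by positivity) (by gcongr))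

theorem LogsGeTwo.le_inv_logDecay (h : LogsGeTwo k x) (hk : k ≠ 0)
    (hB : 1 ≤ B * Real.log^[k] x ^ s) : x ≤ (logDecay k s B x)⁻¹ := by
  have hlog : 0 < Real.log x := h.iterate_log_pos (j := 1) (by omega)
  rw [logDecay, ← Real.exp_neg, neg_neg, ← Real.log_le_iff_le_exp h.1, mul_right_comm]
  exact le_mul_of_one_le_left hlog.le hB

theorem LogsGeTwo.growth_le (h : LogsGeTwo k x) (hk : k ≠ 0) (hα : 0 < α)
    (hB : 1 ≤ B * Real.log^[k] x ^ (1 / α)) (hx : x ≤ lam)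
    (hlam : lam ≤ 8 * (logDecay k (1 / α) B x)⁻¹) : growth k α lam ≤ 9 * B * Real.log x := by
  have hk1 : 1 ≤ k := Nat.one_le_iff_ne_zero.2 hk
  have hlog2 : 2 ≤ Real.log x := h.2 1 le_rfl hk1
  have hiter0 := h.iterate_log_pos le_rfl
  have hiter := h.iterate_log_le_iterate_log hx le_rfl
  have hloglam0 : 0 < Real.log lam := (h.mono hx).iterate_log_pos (j := 1) hk1
  have hloglam : Real.log lam ≤ 9 * (B * Real.log x * Real.log^[k] x ^ (1 / α)) := by
    rw [logDecay, ← Real.exp_neg, neg_neg] at hlam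
    have hle := Real.log_le_log (h.1.trans_le hx) hlam
    rw [Real.log_mul (by norm_num) (Real.exp_ne_zero _), Real.log_exp] at hle
    have h8 : Real.log 8 ≤ 8 := Real.log_le_self (by norm_num)
    nlinarith
  calc growth k α lam
      ≤ 9 * (B * Real.log x * Real.log^[k] x ^ (1 / α)) / Real.log^[k] x ^ (1 / α) := by
        rw [growth]
        gcongr
        exact hloglam0.le.trans hloglam
    _ = 9 * B * Real.log x := by field_simp

theorem LogsGeTwo.growth_nonneg (h : LogsGeTwo k lam) (hk : k ≠ 0) (α : ℝ) :
    0 ≤ growth k α lam :=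
  div_nonneg (h.iterate_log_pos (j := 1) (by omega)).le
    (Real.rpow_nonneg (h.iterate_log_pos le_rfl).le _)

theorem eventually_growth_le_mul_log_inv (hk : k ≠ 0) (hα : 0 < α) (hB : 0 < B)
    (hδ : LogsGeTwo k (1 / δ)) :
    ∀ᶠ t in 𝓝[>] (0 : ℝ),
      ∀ lam ∈ Icc (4 / flatPhase k α B δ t) (2 * (4 / flatPhase k α B δ t)),
        t⁻¹ ≤ lam ∧ growth k α lam ≤ 18 * B * Real.log t⁻¹ := by
  have hδ0 : 0 < δ := one_div_pos.1 hδ.1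
  have hx_top : Tendsto (fun t : ℝ => 1 / (δ * t)) (𝓝[>] 0) atTop := by
    simp_rw [one_div, mul_inv]
    exact tendsto_inv_nhdsGT_zero.const_mul_atTop (inv_pos.2 hδ0)
  have hB_top : Tendsto (fun x : ℝ => B * Real.log^[k] x ^ (1 / α)) atTop atTop :=
    ((tendsto_rpow_atTop (by positivity)).comp (tendsto_iterate_log_atTop k)).const_mul_atTop hB
  filter_upwards [Ioc_mem_nhdsGT one_pos, hx_top.eventually (hB_top.eventually_ge_atTop 1),
    tendsto_inv_nhdsGT_zero.eventually_ge_atTop (1 / δ)] with t ht hBx htδ lam hlam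
  have hlogs := hδ.one_div_mul ht
  have hsplit : 1 / (δ * t) = 1 / δ * t⁻¹ := by rw [one_div, mul_inv, one_div]
  have hlogδ2 : 2 ≤ Real.log (1 / δ) := hδ.2 1 le_rfl (Nat.one_le_iff_ne_zero.2 hk)
  have hlogx : Real.log (1 / (δ * t)) ≤ 2 * Real.log t⁻¹ := by
    rw [hsplit, Real.log_mul hδ.1.ne' (inv_ne_zero ht.1.ne')]
    linarith [Real.log_le_log hδ.1 htδ]
  have htx : t⁻¹ ≤ 1 / (δ * t) := by
    rw [hsplit]
    exact le_mul_of_one_le_left (inv_nonneg.2 ht.1.le)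
      (by linarith [Real.log_le_self hδ.1.le])
  rw [flatPhase_of_pos k α B δ ht.1, div_eq_mul_inv] at hlam
  have hxinv := hlogs.le_inv_logDecay hk hBx
  have hxlam : 1 / (δ * t) ≤ lam := by linarith [hlam.1, hlogs.1]
  refine ⟨htx.trans hxlam, (hlogs.growth_le hk hα hBx hxlam (by linarith [hlam.2])).trans ?_⟩
  calc 9 * B * Real.log (1 / (δ * t)) ≤ 9 * B * (2 * Real.log t⁻¹) := by gcongr
    _ = 18 * B * Real.log t⁻¹ := by ring

theorem exists_isTheta_growth (hk : 2 ≤ k) (hc : 0 < c) (hα : 0 < α) (hB : 0 < B)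
    (hδ : LogsGeTwo k (1 / δ)) (hψ : DenjoyCarleman (weight k c α) (flatPhase k α B δ)) :
    ∃ L : ℕ → ℝ, Tendsto L atTop atTop ∧
      (fun n : ℕ => m (flatPhase k α B δ) (L n)) =Θ[atTop] (fun n : ℕ => growth k α (L n)) := by
  have hk0 : k ≠ 0 := by omega
  have hpoint : ∀ n : ℕ, ((n : ℝ) + 1)⁻¹ ∈ Ioc (0 : ℝ) 1 := fun n =>
    ⟨by positivity, inv_le_one_of_one_le₀ (by simp)⟩
  choose L hL hLm using fun n : ℕ => hψ.exists_half_log_le_norm_m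
    (fun u hu => if_pos hu.le) (monotoneOn_flatPhase hk0 hα hB hδ) (hpoint n)
    (by rw [flatPhase_of_pos k α B δ (hpoint n).1]; exact Real.exp_pos _)
  have htop : Tendsto (fun n : ℕ => (n : ℝ) + 1) atTop atTop :=
    tendsto_atTop_add_const_right _ _ tendsto_natCast_atTop_atTop
  have hgrowth := (tendsto_inv_atTop_nhdsGT_zero.comp htop).eventually
    (eventually_growth_le_mul_log_inv hk0 hα hB hδ)
  have hLtop : Tendsto L atTop atTop := by
    refine tendsto_atTop_mono' _ ?_ htop
    filter_upwards [hgrowth] with n hn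
    simpa using (hn (L n) (hL n)).1
  refine ⟨L, hLtop, (hψ.m_isBigO_growth hk hc hα).comp_tendsto hLtop, IsBigO.of_bound (36 * B) ?_⟩
  filter_upwards [hgrowth, hLtop.eventually (eventually_logsGeTwo k)] with n hn hlogs
  rw [Real.norm_of_nonneg (hlogs.growth_nonneg hk0 α)]
  calc growth k α (L n) ≤ 18 * B * Real.log ((n : ℝ) + 1)⁻¹⁻¹ := (hn (L n) (hL n)).2
    _ = 36 * B * (Real.log ((n : ℝ) + 1)⁻¹⁻¹ / 2) := by ring
    _ ≤ 36 * B * ‖m (flatPhase k α B δ) (L n)‖ := by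
        gcongr
        exact hLm n

theorem two_le_iterate_exp_two (j : ℕ) : 2 ≤ Real.exp^[j] 2 :=
  Function.id_le_iterate_of_id_le (fun y => (by linarith [Real.add_one_le_exp y] :
    y ≤ Real.exp y)) j 2

theorem logsGeTwo_iterate_exp_two (k : ℕ) : LogsGeTwo k (Real.exp^[k] 2) := by
  refine ⟨two_pos.trans_le (two_le_iterate_exp_two k), fun j _ hj => ?_⟩
  obtain ⟨i, rfl⟩ := Nat.exists_eq_add_of_le hj
  rw [Function.iterate_add_apply, Function.LeftInverse.iterate Real.log_exp j]
  exact two_le_iterate_exp_two i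

end Sharpness

end SteinWainger

end

theorem theorem8p1 (k : ℕ) (hk : 2 ≤ k) (c α : ℝ) (hc : 0 < c) (hα : 0 < α) :
    (∀ ψ : ℝ → ℝ, SteinWainger.DenjoyCarleman (SteinWainger.weight k c α) ψ →
      (∀ lam : ℝ, SteinWainger.HasPrincipalValue ψ lam (SteinWainger.m ψ lam)) ∧
      (fun lam : ℝ => SteinWainger.m ψ lam) =O[atTop]
        (fun lam : ℝ => SteinWainger.growth k α lam)) ∧
    (∃ B δ : ℝ, 0 < B ∧ 0 < δ ∧
      (∀ j : ℕ, 1 ≤ j → j ≤ k → 2 ≤ Real.log^[j] (1 / δ)) ∧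
      SteinWainger.DenjoyCarleman (SteinWainger.weight k c α)
        (SteinWainger.flatPhase k α B δ) ∧
      SteinWainger.FlatAtZero (SteinWainger.flatPhase k α B δ) ∧
      ∃ L : ℕ → ℝ, Tendsto L atTop atTop ∧
        (fun n : ℕ => SteinWainger.m (SteinWainger.flatPhase k α B δ) (L n)) =Θ[atTop]
          (fun n : ℕ => SteinWainger.growth k α (L n))) := by
  refine ⟨fun ψ hψ => ⟨fun lam => hψ.m_eq lam ▸ hψ.hasPrincipalValue lam,
    hψ.m_isBigO_growth hk hc hα⟩, ?_⟩
  have hB : 0 < 2 / (c / 2) ^ (1 / α) := by positivity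
  have hBc : (2 / (2 / (c / 2) ^ (1 / α))) ^ α < c := by
    rw [div_div_cancel₀ two_ne_zero, ← Real.rpow_mul (by positivity), one_div_mul_cancel hα.ne',
      Real.rpow_one]
    exact half_lt_self hc
  have hδ : SteinWainger.LogsGeTwo k (1 / (1 / Real.exp^[k] 2)) := by
    rw [one_div_one_div]
    exact SteinWainger.logsGeTwo_iterate_exp_two k
  have hψ := SteinWainger.denjoyCarleman_flatPhase hk hα hB hBc hδ
  exact ⟨_, _, hB, one_div_pos.1 hδ.1, hδ.2, hψ,
    SteinWainger.flatAtZero_flatPhase (by omega) hα hB hδ,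
    SteinWainger.exists_isTheta_growth hk hc hα hB hδ hψ⟩
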